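/- \textbf{Setting.} There are $n$ buyers and $k\ge 1$ sellers; an order is a subset $\gamma$ of the sellers. An order costs $c(\gamma)\in[0,1]$, with $c(\emptyset)=0$. In each round there is a random performance increase $P_i(\gamma)\in[0,1]$, with $P_i(\emptyset)=0$, and a random (integrable) externality $E_{ij}(\gamma)$ that buyer $i$ suffers when buyer $j\neq i$ orders $\gamma$, with $\sum_{j\ne i}E_{ji}(\gamma)\in[0,1]$ for all $i,\gamma$. These variables may be arbitrarily correlated within a round and are independent and identically distributed across rounds. Put $G_i(\gamma)=P_i(\gamma)-c(\gamma)$. For $\alpha\in[0,1]$ the platform charges buyer $i$, at the order profile $S=(\gamma_1,\dots,\gamma_n)$, the transaction cost $\mathcal T_i(S)=\alpha\big(\sum_{j\ne i}E_{ji}(\gamma_i)-\sum_{j\ne i}E_{ij}(\gamma_j)\big)$. The utility of buyer $i$ is $U_i(S)=G_i(\gamma_i)-\sum_{j\ne i}E_{ij}(\gamma_j)-\mathcal T_i(S)$, and her effective utility is $U^e_i(\gamma)=G_i(\gamma)-\alpha\sum_{j\neq i}E_{ji}(\gamma)$, with expectation $\bar u^e_i(\gamma)$. Let $S^*$ maximize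 the expected social welfare $\sum_i\mathbb E[U_i(S)]$, and let $\gamma_i^d$ maximize $\bar u_i^e$. Let $D_h(\gamma,\gamma')=|\gamma\,\triangle\,\gamma'|/k$. Assume closeness with a parameter $\lambda>0$: for all $i$ and $\gamma$, $$\bar u^e_i(\gamma^d_i)-\bar u^e_i(\gamma)\in\big[\lambda\big(D_h(\gamma,\gamma_i^d)-\tfrac1k\big),\ \lambda D_h(\gamma,\gamma_i^d)\big].$$ \textbf{Algorithm.} Let $T\ge2$ be the number of rounds. Every buyer $i$ runs the following zooming algorithm. Her active set $\mathcal A_i$ initially consists of one (possibly random) order. In round $t$, let $n^i_t(\gamma)$ be the number of earlier rounds in which she selected $\gamma$, let $\hat u^e_{i}(\gamma)$ be the average of the values of $U_i^e(\gamma)$ observed in those rounds ($0$ if there are none), and let $c^i_t(\gamma)=\sqrt{12\log T/(n^i_t(\gamma)+1)}$. If some order $\gamma$ is uncovered, meaning that $\lambda D_h(\gamma,\gamma')>c^i_t(\gamma')$ for all $\gamma'\in\mathcal A_i$, then she adds one arbitrary uncovered order to $\mathcal A_i$. Then she selects as $\gamma_i^t$ an order in $\mathcal A_i$ that maximizes $\hat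 u^e_i(\gamma)+2c_t^i(\gamma)$. The initialization and all choices left open may be random and may depend on the past, but not on the present or future rounds' outcomes. Let $S^t=(\gamma^t_1,\dots,\gamma^t_n)$. With utilities in round $t$ evaluated at the outcome of that round, define $$R^i_d(T)=\mathbb E\Big[\sum_{t=1}^T U^e_i(\gamma_i^d)-U^e_i(\gamma_i^t)\Big],\qquad R_w(T)=\sum_{i=1}^n\mathbb E\Big[\sum_{t=1}^T U_i(S^*)-U_i(S^t)\Big].$$ \textbf{Theorem.} There is an absolute constant $C_0>0$, and for every $\lambda>0$ there is a constant $C>0$ that depends only on $\lambda$, such that in the setting above, for all $n$, all $k\ge1$, all $T\ge 2$ and all $\alpha\in[0,1]$, $$R_w(T)\le C_0\,Tn(1-\alpha)+\sum_{i=1}^nR^i_d(T)\le C\Big(Tn(1-\alpha)+nk^2\sqrt{T\log T}+nk^3\log^2(T)\,2^{3k/4}\Big).$$ -/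

import Mathlib

open MeasureTheory ProbabilityTheory

noncomputable section

/-- An order: a subset of the `k` sellers. -/
abbrev SellerSet (k : ℕ) := Finset (Fin k)

/-- The outcome of one round: the performances `P_i(γ)` and the externalities `E_ij(γ)`
(suffered by buyer `i` when buyer `j` orders `γ`). -/
abbrev Draw (n k : ℕ) := (Fin n → SellerSet k → ℝ) × (Fin n → Fin n → SellerSet k → ℝ)

/-- Performance increase `P_i(γ)` in the outcome `x`. -/
def Draw.perf {n k : ℕ} (x : Draw n k) (i : Fin n) (γ : SellerSet k) : ℝ := x.1 i γ

/-- Externality `E_ij(γ)` suffered by `i` when `j` orders `γ`, in the outcome `x`. -/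
def Draw.ext {n k : ℕ} (x : Draw n k) (i j : Fin n) (γ : SellerSet k) : ℝ := x.2 i j γ

/-- A data market with `n` buyers and `k` sellers: the sellers' costs and the joint law of all
performances and externalities in one round. Within a round these may be arbitrarily correlated. -/
structure DataMarket (n k : ℕ) where
  /-- the cost `c(γ)` of an order -/
  cost : SellerSet k → ℝ
  /-- the joint law of one round -/
  law : Measure (Draw n k)
  isProb : IsProbabilityMeasure law
  cost_mem : ∀ γ, cost γ ∈ Set.Icc (0 : ℝ) 1
  cost_empty : cost ∅ = 0
  perf_mem : ∀ i γ, ∀ᵐ x ∂law, Draw.perf x i γ ∈ Set.Icc (0 : ℝ) 1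
  perf_empty : ∀ i, ∀ᵐ x ∂law, Draw.perf x i ∅ = 0
  ext_integrable : ∀ i j, i ≠ j → ∀ γ, Integrable (fun x => Draw.ext x i j γ) law
  /-- the total externality caused by a buyer lies in `[0,1]` -/
  ext_mem : ∀ i γ, ∀ᵐ x ∂law,
    ∑ j ∈ Finset.univ.erase i, Draw.ext x j i γ ∈ Set.Icc (0 : ℝ) 1

namespace DataMarket

variable {n k : ℕ} (M : DataMarket n k) (α : ℝ)

/-- Net gain `G_i(γ) = P_i(γ) - c(γ)`. -/
def gain (x : Draw n k) (i : Fin n) (γ : SellerSet k) : ℝ := x.perf i γ - M.cost γ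

/-- Transaction cost charged to buyer `i`: `α` times the externality that `i` causes minus the
externality that `i` suffers. -/
def transactionCost (x : Draw n k) (i : Fin n) (S : Fin n → SellerSet k) : ℝ :=
  α * (∑ j ∈ Finset.univ.erase i, x.ext j i (S i)
    - ∑ j ∈ Finset.univ.erase i, x.ext i j (S j))

/-- The (stochastic) utility `U_i(S)`. -/
def utility (x : Draw n k) (i : Fin n) (S : Fin n → SellerSet k) : ℝ :=
  M.gain x i (S i) - ∑ j ∈ Finset.univ.erase i, x.ext i j (S j) - transactionCost α x i S

/-- The (stochastic) effective utility `U^e_i(γ) = G_i(γ) - α ∑_{j ≠ i} E_ji(γ)`. -/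
def effUtility (x : Draw n k) (i : Fin n) (γ : SellerSet k) : ℝ :=
  M.gain x i γ - α * ∑ j ∈ Finset.univ.erase i, x.ext j i γ

/-- Expected utility of buyer `i`. -/
def meanUtility (i : Fin n) (S : Fin n → SellerSet k) : ℝ := ∫ x, M.utility α x i S ∂M.law

/-- Expected effective utility of buyer `i`. -/
def meanEffUtility (i : Fin n) (γ : SellerSet k) : ℝ := ∫ x, M.effUtility α x i γ ∂M.law

/-- Expected social welfare. -/
def socialWelfare (S : Fin n → SellerSet k) : ℝ := ∑ i, M.meanUtility α i S

/-- `S` maximizes the expected social welfare. -/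
def IsSocialOptimum (S : Fin n → SellerSet k) : Prop :=
  ∀ S' : Fin n → SellerSet k, M.socialWelfare α S' ≤ M.socialWelfare α S

/-- `Sd i` maximizes the expected effective utility of buyer `i`, for every `i`. -/
def IsDominantProfile (Sd : Fin n → SellerSet k) : Prop :=
  ∀ i γ, M.meanEffUtility α i γ ≤ M.meanEffUtility α i (Sd i)

end DataMarket

/-- Normalized Hamming distance of two orders. -/
def hammingD {k : ℕ} (γ γ' : SellerSet k) : ℝ := ((symmDiff γ γ').card : ℝ) / k

/-- Closeness with parameter `lam`: for every buyer, the expected gap of an order to the optimal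
order lies between `lam * (D - 1/k)` and `lam * D`, with `D` the Hamming distance of the two. -/
def DataMarket.Closeness {n k : ℕ} (M : DataMarket n k) (α lam : ℝ) (Sd : Fin n → SellerSet k) :
    Prop :=
  ∀ i γ, M.meanEffUtility α i (Sd i) - M.meanEffUtility α i γ ∈
    Set.Icc (lam * (hammingD γ (Sd i) - 1 / k)) (lam * hammingD γ (Sd i))

/-! The zooming algorithm of one buyer. Rounds are numbered `0, …, T - 1`; `a s` is the order of
the buyer in round `s`, and `r s γ` is the value of the effective utility of `γ` in round `s`. -/

/-- Number of selections of `γ` before round `t`. -/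
def pulls {k : ℕ} (a : ℕ → SellerSet k) (t : ℕ) (γ : SellerSet k) : ℕ :=
  ((Finset.range t).filter (fun s => a s = γ)).card

/-- Empirical mean of the effective utility of `γ` over the rounds before `t` in which `γ` was
selected (and `0` if there are none). -/
def empMean {k : ℕ} (a : ℕ → SellerSet k) (r : ℕ → SellerSet k → ℝ) (t : ℕ) (γ : SellerSet k) : ℝ :=
  (∑ s ∈ (Finset.range t).filter (fun s => a s = γ), r s γ) / pulls a t γ

/-- Confidence radius. -/
def confRadius {k : ℕ} (T : ℕ) (a : ℕ → SellerSet k) (t : ℕ) (γ : SellerSet k) : ℝ :=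
  Real.sqrt (12 * Real.log T / (pulls a t γ + 1))

/-- Upper confidence bound. -/
def ucb {k : ℕ} (T : ℕ) (a : ℕ → SellerSet k) (r : ℕ → SellerSet k → ℝ) (t : ℕ) (γ : SellerSet k) : ℝ :=
  empMean a r t γ + 2 * confRadius T a t γ

/-- `γ` is covered in round `t` by some order in the active set `A`. -/
def IsCovered {k : ℕ} (lam : ℝ) (T : ℕ) (a : ℕ → SellerSet k) (t : ℕ) (A : Finset (SellerSet k))
    (γ : SellerSet k) : Prop :=
  ∃ γ' ∈ A, lam * hammingD γ γ' ≤ confRadius T a t γ'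

/-- `a` is the sequence of orders that the zooming algorithm with horizon `T` selects against the
effective utilities `r`. Here `A t` is the active set at the beginning of round `t`, and `A (t + 1)`
is the active set from which the order of round `t` is selected. The initial order, the
uncovered order to be activated and the maximizer of the upper confidence bound are arbitrary. -/
structure IsZooming {k : ℕ} (lam : ℝ) (T : ℕ) (r : ℕ → SellerSet k → ℝ)
    (A : ℕ → Finset (SellerSet k)) (a : ℕ → SellerSet k) : Prop where
  init : ∃ γ, A 0 = {γ}
  activate : ∀ t < T, (∃ γ, ¬ IsCovered lam T a t (A t) γ) →
    ∃ γ, ¬ IsCovered lam T a t (A t) γ ∧ A (t + 1) = insert γ (A t)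
  keep : ∀ t < T, (∀ γ, IsCovered lam T a t (A t) γ) → A (t + 1) = A t
  select_mem : ∀ t < T, a t ∈ A (t + 1)
  select_max : ∀ t < T, ∀ γ ∈ A (t + 1), ucb T a r t γ ≤ ucb T a r t (a t)

/-- A `T`-round play of the market `M` in which all buyers use the zooming algorithm.
`X t` is the outcome of round `t`, `a t i` the order of buyer `i` in round `t`, and `A t i` the
active set of buyer `i`. The σ-algebra `ℱ t` is the information available before the outcome of
round `t`, including the randomness of the initialization and of the choices left open by the
algorithm. The outcomes are independent and identically distributed over rounds. -/
structure IsZoomingPlay {n k : ℕ} (M : DataMarket n k) (α lam : ℝ) (T : ℕ)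
    {Ω : Type*} [mΩ : MeasurableSpace Ω] (μ : Measure Ω) (ℱ : Filtration ℕ mΩ)
    (X : ℕ → Ω → Draw n k) (A : ℕ → Fin n → Ω → Finset (SellerSet k))
    (a : ℕ → Fin n → Ω → SellerSet k) : Prop where
  draw_measurable : ∀ t < T, Measurable[ℱ (t + 1)] (X t)
  draw_law : ∀ t < T, μ.map (X t) = M.law
  draw_indep : ∀ t < T, Indep (MeasurableSpace.comap (X t) inferInstance) (ℱ t) μ
  order_measurable : ∀ t < T, ∀ i γ, MeasurableSet[ℱ t] {ω | a t i ω = γ}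
  init_measurable : ∀ i B, MeasurableSet[ℱ 0] {ω | A 0 i ω = B}
  active_measurable : ∀ t < T, ∀ i B, MeasurableSet[ℱ t] {ω | A (t + 1) i ω = B}
  zooming : ∀ i ω, IsZooming lam T (fun s γ => M.effUtility α (X s ω) i γ)
    (fun t => A t i ω) (fun t => a t i ω)

/-- Online effective regret of buyer `i`, the dominant profile being `Sd`. -/
def onlineEffRegret {n k : ℕ} (M : DataMarket n k) (α : ℝ) (T : ℕ)
    {Ω : Type*} [MeasurableSpace Ω] (μ : Measure Ω)
    (X : ℕ → Ω → Draw n k) (a : ℕ → Fin n → Ω → SellerSet k) (Sd : Fin n → SellerSet k)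
    (i : Fin n) : ℝ :=
  ∫ ω, ∑ t ∈ Finset.range T,
    (M.effUtility α (X t ω) i (Sd i) - M.effUtility α (X t ω) i (a t i ω)) ∂μ

/-- Online welfare regret, the social optimum being `Sopt`. -/
def onlineWelfareRegret {n k : ℕ} (M : DataMarket n k) (α : ℝ) (T : ℕ)
    {Ω : Type*} [MeasurableSpace Ω] (μ : Measure Ω)
    (X : ℕ → Ω → Draw n k) (a : ℕ → Fin n → Ω → SellerSet k) (Sopt : Fin n → SellerSet k) : ℝ :=
  ∑ i, ∫ ω, ∑ t ∈ Finset.range T,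
    (M.utility α (X t ω) i Sopt - M.utility α (X t ω) i (fun j => a t j ω)) ∂μ

end

/-!
Fix a buyer, and call the amount by which the mean effective utility of an order falls short of that
of the optimal order its gap. As long as all empirical means are within their confidence radii,
every selected order has a gap of at most three times its radius, so an order of gap `Δ` is selected
at most `108 log T / Δ²` times. By closeness an order at Hamming distance `d` from the optimal one
has a gap of at least `λ (d - 1) / k`. Since a new order is activated only outside the confidence
balls of the active ones, activated orders at the same distance `d` from the optimal one differ in
more than `2 (d - 1) / 7` sellers. For `f = ⌊(d - 1) / 7⌋`, the `(d - f)`-subsets of their symmetric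
differences with the optimal order are therefore pairwise different, so there are at most
`k.choose (d - f) / d.choose f ≤ 18 d (5/3)^k` of them, and `(5/3)^k ≤ 2^(3k/4)`. Over all
distances `d ≥ 2` the orders contribute `O(k³ log T (5/3)^k / λ)` to the regret, and the at most
`k + 1` orders at distance at most `1` contribute `O(√(T log T))` each.

The orders selected in a round are chosen before its outcome, so the deviations at the first `m`
selections of an order generate an exponential supermartingale, and a union bound over the orders
and over `m` shows that some empirical mean is off with probability at most `2 · 2^k / T²`.

Summed over the buyers, the transaction costs cancel, and welfare differs from the total effective
utility by `1 - α` times the externalities caused, which lie between `0` and `1` for each buyer.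
-/

open scoped Finset Nat symmDiff

theorem pow_mul_factorial_le (a j : ℕ) : a ^ j * a ! ≤ a ^ a * j ! := by
  rcases le_total j a with hja | haj
  · calc a ^ j * a ! = a ^ j * (j ! * a.descFactorial (a - j)) := by
          rw [← Nat.factorial_mul_descFactorial (Nat.sub_le a j), Nat.sub_sub_self hja]
      _ ≤ a ^ j * (j ! * a ^ (a - j)) := by
          gcongr
          exact Nat.descFactorial_le_pow a (a - j)
      _ = a ^ a * j ! := by rw [← pow_mul_pow_sub a hja]; ring
  · calc a ^ j * a ! = a ^ a * (a ! * a ^ (j - a)) := by rw [← pow_mul_pow_sub a haj]; ring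
      _ ≤ a ^ a * j ! := by gcongr; exact Nat.factorial_mul_pow_sub_le_factorial haj

/-- A binomial distribution with integral mean is maximal at its mean. -/
theorem pow_mul_pow_mul_choose_le {a b i j : ℕ} (h : i + j = a + b) :
    a ^ i * b ^ j * (a + b).choose i ≤ a ^ a * b ^ b * (a + b).choose a := by
  have choose_eq {i j : ℕ} (h : i + j = a + b) : (a + b).choose i * (i ! * j !) = (a + b)! := by
    rw [← h, Nat.choose_symm_add, ← mul_assoc, Nat.add_choose_mul_factorial_mul_factorial]
  refine Nat.le_of_mul_le_mul_right (c := (i ! * j !) * (a ! * b !)) ?_ (by positivity)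
  calc a ^ i * b ^ j * (a + b).choose i * ((i ! * j !) * (a ! * b !))
      = (a ^ i * a !) * (b ^ j * b !) * (a + b)! := by rw [← choose_eq h]; ring
    _ ≤ (a ^ a * i !) * (b ^ b * j !) * (a + b)! := by
      gcongr ?_ * ?_ * _ <;> exact pow_mul_factorial_le _ _
    _ = a ^ a * b ^ b * (a + b).choose a * ((i ! * j !) * (a ! * b !)) := by
      rw [← choose_eq (rfl : a + b = a + b)]; ring

theorem add_pow_add_le_mul_choose (a b : ℕ) :
    (a + b) ^ (a + b) ≤ (a + b + 1) * (a ^ a * b ^ b * (a + b).choose a) := by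
  calc (a + b) ^ (a + b)
      = ∑ i ∈ Finset.range (a + b + 1), a ^ i * b ^ (a + b - i) * (a + b).choose i := add_pow a b _
    _ ≤ #(Finset.range (a + b + 1)) • (a ^ a * b ^ b * (a + b).choose a) := by
      refine Finset.sum_le_card_nsmul _ _ _ fun i hi => pow_mul_pow_mul_choose_le ?_
      have := Finset.mem_range.1 hi
      lia
    _ = _ := by rw [Finset.card_range, smul_eq_mul]

theorem three_halves_pow_le_choose_seven_mul (f : ℕ) :
    ((3 : ℝ) / 2) ^ (6 * f) ≤ (7 * f + 1) * (7 * f).choose f := by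
  rcases f.eq_zero_or_pos with rfl | hf
  · simp
  have h := add_pow_add_le_mul_choose f (6 * f)
  rw [show f + 6 * f = 7 * f by ring, mul_pow, mul_pow] at h
  have h7 : 7 ^ (7 * f) ≤ (7 * f + 1) * (7 * f).choose f * 6 ^ (6 * f) := by
    refine Nat.le_of_mul_le_mul_right (c := f ^ (7 * f)) (h.trans_eq ?_) (by positivity)
    rw [show 7 * f = f + 6 * f by ring, pow_add f]; ring
  have h9 : 9 ^ (6 * f) ≤ 7 ^ (7 * f) := by
    rw [pow_mul, pow_mul]; exact Nat.pow_le_pow_left (by norm_num) f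
  rw [show (3 : ℝ) / 2 = 9 / 6 by norm_num, div_pow, div_le_iff₀ (by positivity)]
  exact_mod_cast h9.trans h7

theorem choose_mul_pow_le_one_add_pow {x : ℝ} (hx : 0 ≤ x) (n j : ℕ) :
    n.choose j * x ^ j ≤ (1 + x) ^ n := by
  rcases lt_or_ge n j with hj | hj
  · rw [Nat.choose_eq_zero_of_lt hj]; simp only [Nat.cast_zero, zero_mul]; positivity
  rw [add_comm, add_pow]
  refine le_of_eq_of_le (by simp [mul_comm]) (Finset.single_le_sum
    (f := fun m => x ^ m * 1 ^ (n - m) * (n.choose m : ℝ)) (fun i _ => by positivity)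
    (Finset.mem_range.2 (Nat.lt_succ_of_le hj)))

section Packing

variable {ι : Type*} [DecidableEq ι]

theorem card_symmDiff_add_two_mul_card_inter (s t : Finset ι) :
    #(s ∆ t) + 2 * #(s ∩ t) = #s + #t := by
  have hst : #(s ∆ t) = #(s \ t) + #(t \ s) := by
    rw [symmDiff_def, Finset.sup_eq_union, Finset.card_union_of_disjoint disjoint_sdiff_sdiff]
  have hs := Finset.card_sdiff_add_card_inter s t
  have ht := Finset.card_sdiff_add_card_inter t s
  rw [Finset.inter_comm] at ht
  lia

variable [Fintype ι] {C : Finset (Finset ι)} {d f : ℕ}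

/-- The `(d - f)`-subsets of the members of `C` are pairwise different. -/
theorem card_mul_choose_le_of_separated (hC : (C : Set (Finset ι)).Sized d) (hf : f ≤ d)
    (hsep : (C : Set (Finset ι)).Pairwise fun c c' => 2 * f < #(c ∆ c')) :
    #C * d.choose f ≤ (Fintype.card ι).choose (d - f) := by
  have hdisj : (C : Set (Finset ι)).PairwiseDisjoint fun c => c.powersetCard (d - f) := by
    intro c hc c' hc' hne
    refine Finset.disjoint_left.2 fun z hz hz' => ?_
    rw [Finset.mem_powersetCard] at hz hz'
    have hz_le := Finset.card_le_card (Finset.subset_inter hz.1 hz'.1)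
    have hcard := card_symmDiff_add_two_mul_card_inter c c'
    have hcc' := hsep hc hc' hne
    rw [hC hc, hC hc'] at hcard
    lia
  calc #C * d.choose f = ∑ c ∈ C, #(c.powersetCard (d - f)) := by
        rw [Finset.sum_congr rfl fun c hc => by
          rw [Finset.card_powersetCard, hC hc, Nat.choose_symm hf], Finset.sum_const, smul_eq_mul]
    _ = #(C.biUnion fun c => c.powersetCard (d - f)) := (Finset.card_biUnion hdisj).symm
    _ ≤ #((Finset.univ : Finset ι).powersetCard (d - f)) :=
        Finset.card_le_card <| Finset.biUnion_subset.2 fun c _ =>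
          Finset.powersetCard_mono (Finset.subset_univ c)
    _ = _ := by rw [Finset.card_powersetCard, Finset.card_univ]

theorem card_le_of_separated (hC : (C : Set (Finset ι)).Sized d) (hd : 1 ≤ d)
    (hsep : (C : Set (Finset ι)).Pairwise fun c c' => 2 * ((d - 1) / 7) < #(c ∆ c')) :
    (#C : ℝ) ≤ 18 * d * (5 / 3) ^ Fintype.card ι := by
  set f := (d - 1) / 7
  have hchoose : (3 / 2 : ℝ) ^ (d - f) ≤ 18 * d * d.choose f := by
    calc (3 / 2 : ℝ) ^ (d - f) ≤ (3 / 2) ^ (6 * f + 7) := by gcongr <;> [norm_num; lia]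
      _ ≤ (3 / 2) ^ (6 * f) * 18 := by rw [pow_add]; gcongr; norm_num
      _ ≤ (7 * f + 1) * (7 * f).choose f * 18 := by
        gcongr; exact three_halves_pow_le_choose_seven_mul f
      _ ≤ d * d.choose f * 18 := by
        have hfd : 7 * f + 1 ≤ d := by lia
        gcongr <;> [exact_mod_cast hfd; lia]
      _ = 18 * d * d.choose f := by ring
  have hpack : (#C : ℝ) * d.choose f ≤ (Fintype.card ι).choose (d - f) :=
    mod_cast card_mul_choose_le_of_separated hC (by lia) hsep
  have hchoose_pos : (0 : ℝ) < d.choose f := mod_cast Nat.choose_pos (by lia : f ≤ d)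
  refine le_of_mul_le_mul_right ?_ hchoose_pos
  calc (#C : ℝ) * d.choose f ≤ (Fintype.card ι).choose (d - f) := hpack
    _ = (Fintype.card ι).choose (d - f) * (2 / 3) ^ (d - f) * (3 / 2) ^ (d - f) := by
      rw [mul_assoc, ← mul_pow]; norm_num
    _ ≤ (1 + 2 / 3) ^ Fintype.card ι * (18 * d * d.choose f) := by
      gcongr; exact choose_mul_pow_le_one_add_pow (by norm_num) _ _
    _ = 18 * d * (5 / 3) ^ Fintype.card ι * d.choose f := by norm_num; ring

theorem card_le_of_separated_sphere {s : Finset ι} (hC : ∀ c ∈ C, #(c ∆ s) = d) (hd : 1 ≤ d)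
    (hsep : (C : Set (Finset ι)).Pairwise fun c c' => 2 * ((d - 1) / 7) < #(c ∆ c')) :
    (#C : ℝ) ≤ 18 * d * (5 / 3) ^ Fintype.card ι := by
  rw [← Finset.card_image_of_injective C (symmDiff_left_injective s)]
  refine card_le_of_separated ?_ hd ?_
  · rw [Finset.coe_image]
    rintro _ ⟨c, hc, rfl⟩
    exact hC c hc
  · rw [Finset.coe_image]
    rintro _ ⟨c, hc, rfl⟩ _ ⟨c', hc', rfl⟩ hne
    dsimp only
    rw [symmDiff_symmDiff_symmDiff_comm, symmDiff_self, symmDiff_bot]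
    exact hsep hc hc' fun h => hne (by rw [h])

theorem card_filter_card_symmDiff_le_one (s : Finset ι) :
    #{t : Finset ι | #(t ∆ s) ≤ 1} ≤ Fintype.card ι + 1 := by
  have hsub : ({t : Finset ι | #(t ∆ s) ≤ 1} : Finset (Finset ι)).image (· ∆ s) ⊆
      insert ∅ (Finset.univ.image singleton) := by
    refine Finset.image_subset_iff.2 fun t ht => ?_
    rcases Nat.le_one_iff_eq_zero_or_eq_one.1 (Finset.mem_filter.1 ht).2 with h | h
    · simp [Finset.card_eq_zero.1 h]
    · obtain ⟨i, hi⟩ := Finset.card_eq_one.1 h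
      simp [hi]
  calc #{t : Finset ι | #(t ∆ s) ≤ 1}
      = #(({t : Finset ι | #(t ∆ s) ≤ 1} : Finset (Finset ι)).image (· ∆ s)) :=
        (Finset.card_image_of_injective _ (symmDiff_left_injective s)).symm
    _ ≤ #(insert ∅ (Finset.univ.image (singleton : ι → Finset ι))) := Finset.card_le_card hsub
    _ ≤ Fintype.card ι + 1 :=
        (Finset.card_insert_le _ _).trans (Nat.succ_le_succ Finset.card_image_le)

end Packing

theorem five_thirds_pow_le (k : ℕ) : (5 / 3 : ℝ) ^ k ≤ 2 ^ (3 * (k : ℝ) / 4) := by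
  have h : (5 / 3 : ℝ) ≤ 2 ^ (3 / 4 : ℝ) := by
    refine le_of_pow_le_pow_left₀ (n := 4) (by norm_num) (by positivity) ?_
    rw [← Real.rpow_mul_natCast (by norm_num)]
    norm_num
  calc (5 / 3 : ℝ) ^ k ≤ (2 ^ (3 / 4 : ℝ)) ^ k := by gcongr
    _ = 2 ^ (3 * (k : ℝ) / 4) := by rw [← Real.rpow_mul_natCast (by norm_num)]; ring_nf

section Orders

variable {k : ℕ}

theorem hammingD_self (γ : SellerSet k) : hammingD γ γ = 0 := by
  simp [hammingD]

theorem hammingD_comm (γ γ' : SellerSet k) : hammingD γ γ' = hammingD γ' γ := by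
  rw [hammingD, hammingD, symmDiff_comm]

theorem card_symmDiff_le (γ γ' : SellerSet k) : #(γ ∆ γ') ≤ k := by
  simpa using Finset.card_le_univ (γ ∆ γ')

theorem hammingD_le_one (γ γ' : SellerSet k) : hammingD γ γ' ≤ 1 :=
  div_le_one_of_le₀ (mod_cast card_symmDiff_le γ γ') (Nat.cast_nonneg k)

theorem pulls_succ (a : ℕ → SellerSet k) (t : ℕ) (γ : SellerSet k) :
    pulls a (t + 1) γ = pulls a t γ + if a t = γ then 1 else 0 := by
  unfold pulls
  rw [Finset.range_add_one, Finset.filter_insert]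
  split_ifs
  · rw [Finset.card_insert_of_notMem (by simp)]
  · rfl

theorem pulls_le (a : ℕ → SellerSet k) (t : ℕ) (γ : SellerSet k) : pulls a t γ ≤ t :=
  (Finset.card_filter_le _ _).trans_eq (Finset.card_range t)

theorem sum_range_eq_sum_pulls_mul (a : ℕ → SellerSet k) (T : ℕ) (g : SellerSet k → ℝ) :
    ∑ t ∈ Finset.range T, g (a t) = ∑ γ, pulls a T γ * g γ := by
  simp only [← Finset.sum_fiberwise' (Finset.range T) a g, Finset.sum_const, nsmul_eq_mul, pulls]

theorem confRadius_nonneg (T : ℕ) (a : ℕ → SellerSet k) (t : ℕ) (γ : SellerSet k) :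
    0 ≤ confRadius T a t γ := Real.sqrt_nonneg _

theorem confRadius_sq (T : ℕ) (a : ℕ → SellerSet k) (t : ℕ) (γ : SellerSet k) :
    confRadius T a t γ ^ 2 = 12 * Real.log T / (pulls a t γ + 1) :=
  Real.sq_sqrt (by have := Real.log_natCast_nonneg T; positivity)

/-- All confidence intervals of the first `T` rounds contain the true means `u`: the clean event of
the zooming algorithm, for one realization of its orders `a` and observed utilities `r`. -/
def HasAccurateMeans (T : ℕ) (a : ℕ → SellerSet k) (r : ℕ → SellerSet k → ℝ)
    (u : SellerSet k → ℝ) : Prop :=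
  ∀ t < T, ∀ γ, |empMean a r t γ - u γ| ≤ confRadius T a t γ

/-- Closeness for a single buyer with mean effective utilities `u` and optimal order `γd`, so that
`DataMarket.Closeness` says that all buyers satisfy it. -/
def IsHammingClose (lam : ℝ) (u : SellerSet k → ℝ) (γd : SellerSet k) : Prop :=
  ∀ γ, u γd - u γ ∈ Set.Icc (lam * (hammingD γ γd - 1 / k)) (lam * hammingD γ γd)

end Orders

namespace IsHammingClose

variable {k : ℕ} {lam : ℝ} {u : SellerSet k → ℝ} {γd : SellerSet k}

theorem gap_nonneg (hu : IsHammingClose lam u γd) (hlam : 0 ≤ lam) (γ : SellerSet k) :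
    0 ≤ u γd - u γ := by
  rcases eq_or_ne γ γd with rfl | hne
  · exact (sub_self (u γ)).ge
  have hcard : (1 : ℝ) ≤ #(γ ∆ γd) := by
    exact_mod_cast Finset.card_pos.2 (Finset.symmDiff_nonempty.2 hne)
  refine le_trans (mul_nonneg hlam ?_) (hu γ).1
  rw [hammingD, ← sub_div]
  have := sub_nonneg.2 hcard
  positivity

theorem gap_le (hu : IsHammingClose lam u γd) (hlam : 0 ≤ lam) (γ : SellerSet k) :
    u γd - u γ ≤ lam :=
  (hu γ).2.trans (mul_le_of_le_one_right hlam (hammingD_le_one γ γd))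

theorem sum_gap_le (hu : IsHammingClose lam u γd) (hlam : 0 ≤ lam) (a : ℕ → SellerSet k) (T : ℕ) :
    ∑ t ∈ Finset.range T, (u γd - u (a t)) ≤ lam * T := by
  simpa [mul_comm] using Finset.sum_le_card_nsmul (Finset.range T) _ lam fun t _ =>
    hu.gap_le hlam (a t)

theorem mul_card_sub_one_le (hu : IsHammingClose lam u γd) (hlam : 0 ≤ lam) (γ : SellerSet k) :
    lam * (#(γ ∆ γd) - 1) ≤ k * (u γd - u γ) := by
  have hk : (0 : ℝ) ≤ k := Nat.cast_nonneg k
  calc lam * (#(γ ∆ γd) - 1) ≤ lam * (k * (hammingD γ γd - 1 / k)) := by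
        gcongr
        rcases hk.eq_or_lt with hk | hk
        · have := card_symmDiff_le γ γd
          rify at this
          rw [← hk]
          linarith
        · rw [hammingD]
          field_simp
          rfl
    _ = k * (lam * (hammingD γ γd - 1 / k)) := by ring
    _ ≤ k * (u γd - u γ) := by gcongr; exact (hu γ).1

end IsHammingClose

namespace IsZooming

variable {k T : ℕ} {lam : ℝ} {r : ℕ → SellerSet k → ℝ} {A : ℕ → Finset (SellerSet k)}
  {a : ℕ → SellerSet k}

theorem active_subset_succ (hz : IsZooming lam T r A a) {t : ℕ} (ht : t < T) :
    A t ⊆ A (t + 1) := by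
  by_cases h : ∃ γ, ¬ IsCovered lam T a t (A t) γ
  · obtain ⟨γ, _, hA⟩ := hz.activate t ht h
    exact hA ▸ Finset.subset_insert γ (A t)
  · exact (hz.keep t ht (not_exists_not.1 h)).ge

theorem pulls_eq_zero (hz : IsZooming lam T r A a) {t : ℕ} (ht : t ≤ T) {γ : SellerSet k}
    (hγ : γ ∉ A t) : pulls a t γ = 0 := by
  induction t with
  | zero => simp [pulls]
  | succ t ih =>
    rw [pulls_succ, ih (by lia) fun h => hγ (hz.active_subset_succ (by lia) h), if_neg]
    rintro rfl
    exact hγ (hz.select_mem t (by lia))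

theorem notMem_of_not_isCovered {t : ℕ} {γ : SellerSet k} {B : Finset (SellerSet k)}
    (h : ¬ IsCovered lam T a t B γ) : γ ∉ B := fun hγ =>
  h ⟨γ, hγ, by rw [hammingD_self, mul_zero]; exact confRadius_nonneg T a t γ⟩

/-- A freshly activated order has no pulls, so its confidence ball is the whole cube. -/
theorem isCovered_active_succ (hz : IsZooming lam T r A a) (hlam : 0 ≤ lam)
    (hT : lam ≤ √(12 * Real.log T)) {t : ℕ} (ht : t < T) (γ : SellerSet k) :
    IsCovered lam T a t (A (t + 1)) γ := by
  by_cases h : ∃ γ, ¬ IsCovered lam T a t (A t) γ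
  · obtain ⟨γ', hγ', hA⟩ := hz.activate t ht h
    refine ⟨γ', hA ▸ Finset.mem_insert_self γ' _, ?_⟩
    rw [confRadius, hz.pulls_eq_zero ht.le (notMem_of_not_isCovered hγ'), Nat.cast_zero, zero_add,
      div_one]
    exact (mul_le_of_le_one_right hlam (hammingD_le_one γ γ')).trans hT
  · rw [hz.keep t ht (not_exists_not.1 h)]
    exact not_exists_not.1 h γ

variable {u : SellerSet k → ℝ} {γd : SellerSet k}

theorem gap_le_three_mul_confRadius (hz : IsZooming lam T r A a) (hlam : 0 ≤ lam)
    (hT : lam ≤ √(12 * Real.log T)) (hacc : HasAccurateMeans T a r u)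
    (hu : IsHammingClose lam u γd) {t : ℕ} (ht : t < T) :
    u γd - u (a t) ≤ 3 * confRadius T a t (a t) := by
  obtain ⟨γ', hγ', hcov⟩ := hz.isCovered_active_succ hlam hT ht γd
  have hucb : ucb T a r t γ' ≤ ucb T a r t (a t) := hz.select_max t ht γ' hγ'
  have hgap := (hu γ').2
  rw [hammingD_comm] at hgap
  have hlow := (abs_le.1 (hacc t ht γ')).1
  have hupp := (abs_le.1 (hacc t ht (a t))).2
  unfold ucb at hucb
  linarith

theorem pulls_mul_gap_sq_le (hz : IsZooming lam T r A a) (hlam : 0 ≤ lam)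
    (hT : lam ≤ √(12 * Real.log T)) (hacc : HasAccurateMeans T a r u)
    (hu : IsHammingClose lam u γd) {t : ℕ} (ht : t ≤ T) (γ : SellerSet k) :
    pulls a t γ * (u γd - u γ) ^ 2 ≤ 108 * Real.log T := by
  induction t with
  | zero => simpa [pulls] using Real.log_natCast_nonneg T
  | succ t ih =>
    rw [pulls_succ]
    split_ifs with hγ
    · have hgap := hz.gap_le_three_mul_confRadius hlam hT hacc hu (t := t) (by lia)
      rw [hγ] at hgap
      push_cast
      calc ((pulls a t γ : ℝ) + 1) * (u γd - u γ) ^ 2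
          ≤ (pulls a t γ + 1) * (3 * confRadius T a t γ) ^ 2 := by
            gcongr
            exact hu.gap_nonneg hlam γ
        _ = 108 * Real.log T := by
            rw [mul_pow, confRadius_sq]
            field_simp
            ring
    · exact ih (by lia)

theorem gap_le_confRadius (hz : IsZooming lam T r A a) (hlam : 0 ≤ lam)
    (hT : lam ≤ √(12 * Real.log T)) (hacc : HasAccurateMeans T a r u)
    (hu : IsHammingClose lam u γd) {t : ℕ} (ht : t ≤ T) (γ : SellerSet k) :
    u γd - u γ ≤ 7 / 2 * confRadius T a t γ := by
  have hlog := Real.log_natCast_nonneg T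
  have hpulls := hz.pulls_mul_gap_sq_le hlam hT hacc hu ht γ
  have hgap_sq : (u γd - u γ) ^ 2 ≤ 12 * Real.log T := by
    rw [← Real.sq_sqrt (by positivity : (0 : ℝ) ≤ 12 * Real.log T)]
    gcongr
    exacts [hu.gap_nonneg hlam γ, (hu.gap_le hlam γ).trans hT]
  have hconf := confRadius_nonneg T a t γ
  refine le_of_pow_le_pow_left₀ two_ne_zero (by positivity) ?_
  rw [mul_pow, confRadius_sq, ← mul_div_assoc, le_div_iff₀ (by positivity)]
  linarith

theorem pairwise_active_min_gap_lt (hz : IsZooming lam T r A a) (hlam : 0 ≤ lam)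
    (hT : lam ≤ √(12 * Real.log T)) (hacc : HasAccurateMeans T a r u)
    (hu : IsHammingClose lam u γd) {t : ℕ} (ht : t ≤ T) :
    (A t : Set (SellerSet k)).Pairwise fun γ γ' =>
      min (u γd - u γ) (u γd - u γ') < 7 / 2 * (lam * hammingD γ γ') := by
  induction t with
  | zero =>
    obtain ⟨γ, hγ⟩ := hz.init
    rw [hγ, Finset.coe_singleton]
    exact Set.pairwise_singleton _ _
  | succ t ih =>
    by_cases h : ∃ γ, ¬ IsCovered lam T a t (A t) γ
    · obtain ⟨γ, hγ, hA⟩ := hz.activate t (by lia) h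
      have hsymm : Std.Symm fun γ γ' : SellerSet k =>
          min (u γd - u γ) (u γd - u γ') < 7 / 2 * (lam * hammingD γ γ') :=
        ⟨fun γ γ' h => by rwa [min_comm, hammingD_comm]⟩
      rw [hA, Finset.coe_insert, Set.pairwise_insert_of_symm]
      refine ⟨ih (by lia), fun γ' hγ' _ => ?_⟩
      have hfar : confRadius T a t γ' < lam * hammingD γ γ' :=
        not_le.1 fun hle => hγ ⟨γ', hγ', hle⟩
      calc min (u γd - u γ) (u γd - u γ') ≤ u γd - u γ' := min_le_right _ _
        _ ≤ 7 / 2 * confRadius T a t γ' := hz.gap_le_confRadius hlam hT hacc hu (by lia) γ'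
        _ < 7 / 2 * (lam * hammingD γ γ') := by gcongr
    · rw [hz.keep t (by lia) (not_exists_not.1 h)]
      exact ih (by lia)

theorem card_active_sphere_le (hz : IsZooming lam T r A a) (hlam : 0 ≤ lam)
    (hT : lam ≤ √(12 * Real.log T)) (hacc : HasAccurateMeans T a r u)
    (hu : IsHammingClose lam u γd) {t d : ℕ} (ht : t ≤ T) (hd : 1 ≤ d) :
    (#{γ ∈ A t | #(γ ∆ γd) = d} : ℝ) ≤ 18 * d * (5 / 3) ^ k := by
  have hsep : (({γ ∈ A t | #(γ ∆ γd) = d} : Finset (SellerSet k)) : Set (SellerSet k)).Pairwise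
      fun γ γ' => 2 * ((d - 1) / 7) < #(γ ∆ γ') := by
    intro γ hγ γ' hγ' hne
    obtain ⟨hγ, hγd⟩ := Finset.mem_filter.1 hγ
    obtain ⟨hγ', hγd'⟩ := Finset.mem_filter.1 hγ'
    have hmin := hz.pairwise_active_min_gap_lt hlam hT hacc hu ht hγ hγ' hne
    have hgap := hu.mul_card_sub_one_le hlam γ
    have hgap' := hu.mul_card_sub_one_le hlam γ'
    rw [hγd] at hgap
    rw [hγd'] at hgap'
    have hk : (0 : ℝ) < k := mod_cast hd.trans (hγd ▸ card_symmDiff_le γ γd)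
    have hlt : lam * (d - 1) < lam * (7 / 2 * #(γ ∆ γ')) := by
      calc lam * (d - 1) ≤ k * min (u γd - u γ) (u γd - u γ') := by
            rw [mul_min_of_nonneg _ _ hk.le]; exact le_min hgap hgap'
        _ < k * (7 / 2 * (lam * hammingD γ γ')) := by gcongr
        _ = lam * (7 / 2 * #(γ ∆ γ')) := by rw [hammingD]; field_simp
    have hcard := lt_of_mul_lt_mul_left hlt hlam
    have : 2 * d < 7 * #(γ ∆ γ') + 2 := by rify; linarith
    lia
  simpa using card_le_of_separated_sphere (fun γ hγ => (Finset.mem_filter.1 hγ).2) hd hsep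

theorem card_active_far_le (hz : IsZooming lam T r A a) (hlam : 0 ≤ lam)
    (hT : lam ≤ √(12 * Real.log T)) (hacc : HasAccurateMeans T a r u)
    (hu : IsHammingClose lam u γd) {t : ℕ} (ht : t ≤ T) :
    (#{γ ∈ A t | ¬ #(γ ∆ γd) ≤ 1} : ℝ) ≤ 18 * k ^ 2 * (5 / 3) ^ k := by
  have hmaps : ∀ γ ∈ ({γ ∈ A t | ¬ #(γ ∆ γd) ≤ 1} : Finset (SellerSet k)),
      #(γ ∆ γd) ∈ Finset.Icc 1 k := fun γ hγ =>
    Finset.mem_Icc.2 ⟨(not_le.1 (Finset.mem_filter.1 hγ).2).le, card_symmDiff_le γ γd⟩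
  rw [Finset.card_eq_sum_card_fiberwise hmaps, Nat.cast_sum]
  calc ∑ d ∈ Finset.Icc 1 k, (#{γ ∈ ({γ ∈ A t | ¬ #(γ ∆ γd) ≤ 1} : Finset (SellerSet k)) |
          #(γ ∆ γd) = d} : ℝ)
      ≤ ∑ d ∈ Finset.Icc 1 k, (18 * k * (5 / 3) ^ k : ℝ) := by
        refine Finset.sum_le_sum fun d hd => ?_
        obtain ⟨hd, hdk⟩ := Finset.mem_Icc.1 hd
        calc (#{γ ∈ ({γ ∈ A t | ¬ #(γ ∆ γd) ≤ 1} : Finset (SellerSet k)) | #(γ ∆ γd) = d} : ℝ)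
            ≤ #{γ ∈ A t | #(γ ∆ γd) = d} := by gcongr; exact Finset.filter_subset _ _
          _ ≤ 18 * d * (5 / 3) ^ k := hz.card_active_sphere_le hlam hT hacc hu ht hd
          _ ≤ 18 * k * (5 / 3) ^ k := by gcongr
    _ = 18 * k ^ 2 * (5 / 3) ^ k := by simp; ring

theorem pulls_mul_gap_le_sqrt (hz : IsZooming lam T r A a) (hlam : 0 ≤ lam)
    (hT : lam ≤ √(12 * Real.log T)) (hacc : HasAccurateMeans T a r u)
    (hu : IsHammingClose lam u γd) (γ : SellerSet k) :
    pulls a T γ * (u γd - u γ) ≤ √(108 * (T * Real.log T)) := by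
  refine Real.le_sqrt_of_sq_le ?_
  calc ((pulls a T γ : ℝ) * (u γd - u γ)) ^ 2
      = pulls a T γ * (pulls a T γ * (u γd - u γ) ^ 2) := by ring
    _ ≤ T * (108 * Real.log T) := by
      gcongr ?_ * ?_
      exacts [mod_cast pulls_le a T γ, hz.pulls_mul_gap_sq_le hlam hT hacc hu le_rfl γ]
    _ = 108 * (T * Real.log T) := by ring

theorem pulls_mul_gap_le_of_far (hz : IsZooming lam T r A a) (hlam : 0 < lam)
    (hT : lam ≤ √(12 * Real.log T)) (hacc : HasAccurateMeans T a r u)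
    (hu : IsHammingClose lam u γd) {γ : SellerSet k} (hγ : ¬ #(γ ∆ γd) ≤ 1) :
    pulls a T γ * (u γd - u γ) ≤ 108 * Real.log T * k / lam := by
  have hgap := hu.gap_nonneg hlam.le γ
  have hlam_le : lam ≤ k * (u γd - u γ) := by
    refine le_trans (le_mul_of_one_le_right hlam.le ?_) (hu.mul_card_sub_one_le hlam.le γ)
    have : (2 : ℝ) ≤ #(γ ∆ γd) := mod_cast not_le.1 hγ
    linarith
  rw [le_div_iff₀ hlam]
  calc pulls a T γ * (u γd - u γ) * lam
      ≤ pulls a T γ * (u γd - u γ) * (k * (u γd - u γ)) := by gcongr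
    _ = pulls a T γ * (u γd - u γ) ^ 2 * k := by ring
    _ ≤ 108 * Real.log T * k := by
      gcongr ?_ * _; exact hz.pulls_mul_gap_sq_le hlam.le hT hacc hu le_rfl γ

theorem sum_near_pulls_mul_gap_le (hz : IsZooming lam T r A a) (hlam : 0 ≤ lam)
    (hT : lam ≤ √(12 * Real.log T)) (hacc : HasAccurateMeans T a r u)
    (hu : IsHammingClose lam u γd) :
    ∑ γ with #(γ ∆ γd) ≤ 1, pulls a T γ * (u γd - u γ) ≤ (k + 1) * √(108 * (T * Real.log T)) := by
  refine (Finset.sum_le_card_nsmul _ _ _ fun γ _ =>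
    hz.pulls_mul_gap_le_sqrt hlam hT hacc hu γ).trans ?_
  rw [nsmul_eq_mul]
  gcongr
  have := card_filter_card_symmDiff_le_one γd
  rw [Fintype.card_fin] at this
  exact_mod_cast this

theorem sum_far_pulls_mul_gap_le (hz : IsZooming lam T r A a) (hlam : 0 < lam)
    (hT : lam ≤ √(12 * Real.log T)) (hacc : HasAccurateMeans T a r u)
    (hu : IsHammingClose lam u γd) :
    ∑ γ with ¬ #(γ ∆ γd) ≤ 1, pulls a T γ * (u γd - u γ) ≤
      1944 * k ^ 3 * Real.log T * (5 / 3) ^ k / lam := by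
  have := Real.log_natCast_nonneg T
  calc ∑ γ with ¬ #(γ ∆ γd) ≤ 1, pulls a T γ * (u γd - u γ)
      = ∑ γ ∈ A T with ¬ #(γ ∆ γd) ≤ 1, pulls a T γ * (u γd - u γ) := by
        refine (Finset.sum_subset (Finset.filter_subset_filter _ (Finset.subset_univ _))
          fun γ hγ hγ' => ?_).symm
        have hγA : γ ∉ A T := fun h =>
          hγ' (Finset.mem_filter.2 ⟨h, (Finset.mem_filter.1 hγ).2⟩)
        rw [hz.pulls_eq_zero le_rfl hγA, Nat.cast_zero, zero_mul]
    _ ≤ #{γ ∈ A T | ¬ #(γ ∆ γd) ≤ 1} • (108 * Real.log T * k / lam) :=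
        Finset.sum_le_card_nsmul _ _ _ fun γ hγ =>
          hz.pulls_mul_gap_le_of_far hlam hT hacc hu (Finset.mem_filter.1 hγ).2
    _ ≤ 18 * k ^ 2 * (5 / 3) ^ k * (108 * Real.log T * k / lam) := by
        rw [nsmul_eq_mul]
        gcongr
        exact hz.card_active_far_le hlam.le hT hacc hu le_rfl
    _ = 1944 * k ^ 3 * Real.log T * (5 / 3) ^ k / lam := by ring

theorem sum_gap_le (hz : IsZooming lam T r A a) (hlam : 0 < lam)
    (hT : lam ≤ √(12 * Real.log T)) (hacc : HasAccurateMeans T a r u)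
    (hu : IsHammingClose lam u γd) :
    ∑ t ∈ Finset.range T, (u γd - u (a t)) ≤
      (k + 1) * √(108 * (T * Real.log T)) + 1944 * k ^ 3 * Real.log T * (5 / 3) ^ k / lam := by
  rw [sum_range_eq_sum_pulls_mul a T fun γ => u γd - u γ,
    ← Finset.sum_filter_add_sum_filter_not _ fun γ => #(γ ∆ γd) ≤ 1]
  exact add_le_add (hz.sum_near_pulls_mul_gap_le hlam.le hT hacc hu)
    (hz.sum_far_pulls_mul_gap_le hlam hT hacc hu)

end IsZooming

section Selection

theorem apply_eq_sum_indicator {Ω β : Type*} [Fintype β] (b : Ω → β) (g : β → Ω → ℝ) :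
    (fun ω => g (b ω) ω) = fun ω => ∑ v, {ω | b ω = v}.indicator (g v) ω := by
  funext ω
  rw [Finset.sum_eq_single_of_mem (b ω) (Finset.mem_univ _) fun v _ hv =>
    Set.indicator_of_notMem (fun h => hv h.symm) _]
  exact (Set.indicator_of_mem (s := {ω' | b ω' = b ω}) rfl (g (b ω))).symm

variable {Ω 𝓧 β : Type*} {m mΩ : MeasurableSpace Ω} [MeasurableSpace 𝓧] [Finite β]
  {μ : Measure Ω} {X : Ω → 𝓧} {b : Ω → β}

theorem integrable_selected (hb : ∀ v, MeasurableSet {ω | b ω = v}) {g : β → Ω → ℝ}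
    (hg : ∀ v, Integrable (g v) μ) : Integrable (fun ω => g (b ω) ω) μ := by
  have := Fintype.ofFinite β
  rw [apply_eq_sum_indicator]
  exact integrable_finsetSum _ fun v _ => (hg v).indicator (hb v)

theorem integral_selected [IsFiniteMeasure μ] (hm : m ≤ mΩ) (hX : Measurable X)
    (hind : Indep (MeasurableSpace.comap X inferInstance) m μ)
    (hb : ∀ v, MeasurableSet[m] {ω | b ω = v}) {g : β → 𝓧 → ℝ}
    (hg : ∀ v, Integrable (g v) (μ.map X)) :
    ∫ ω, g (b ω) (X ω) ∂μ = ∫ ω, ∫ x, g (b ω) x ∂(μ.map X) ∂μ := by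
  have := Fintype.ofFinite β
  have hgX (v : β) : Integrable (fun ω => g v (X ω)) μ := (hg v).comp_measurable hX
  rw [apply_eq_sum_indicator b fun v ω => g v (X ω),
    apply_eq_sum_indicator b fun v _ => ∫ x, g v x ∂(μ.map X),
    integral_finsetSum _ fun v _ => (hgX v).indicator (hm _ (hb v)),
    integral_finsetSum _ fun v _ => (integrable_const _).indicator (hm _ (hb v))]
  refine Finset.sum_congr rfl fun v _ => ?_
  rw [integral_indicator (hm _ (hb v)), integral_indicator (hm _ (hb v)), setIntegral_const,
    hind.symm.setIntegral_eq_mul hm hX.aemeasurable (hb v) (hg v).aestronglyMeasurable,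
    smul_eq_mul, integral_map hX.aemeasurable (hg v).aestronglyMeasurable]

end Selection

section PredictableProduct

variable {Ω : Type*} [mΩ : MeasurableSpace Ω] {μ : Measure Ω} {ℱ : Filtration ℕ mΩ}
  {B : ℕ → Set Ω} {t : ℕ}

theorem measurable_prod_mulIndicator {f : ℕ → Ω → ENNReal}
    (hf : ∀ s < t, Measurable[ℱ (s + 1)] (f s)) (hB : ∀ s < t, MeasurableSet[ℱ s] (B s)) :
    Measurable[ℱ t] fun ω => ∏ s ∈ Finset.range t, (B s).mulIndicator (f s) ω := by
  refine Finset.measurable_prod _ fun s hs => ?_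
  have hst := Finset.mem_range.1 hs
  classical
  exact Measurable.piecewise (ℱ.mono hst.le _ (hB s hst)) ((hf s hst).mono (ℱ.mono hst) le_rfl)
    measurable_const

theorem lintegral_prod_mulIndicator_le_one [IsProbabilityMeasure μ] {f : ℕ → Ω → ENNReal}
    (hf : ∀ s < t, Measurable[ℱ (s + 1)] (f s))
    (hind : ∀ s < t, Indep (MeasurableSpace.comap (f s) inferInstance) (ℱ s) μ)
    (hB : ∀ s < t, MeasurableSet[ℱ s] (B s)) (hle : ∀ s < t, ∫⁻ ω, f s ω ∂μ ≤ 1) :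
    ∫⁻ ω, ∏ s ∈ Finset.range t, (B s).mulIndicator (f s) ω ∂μ ≤ 1 := by
  induction t with
  | zero => simp
  | succ t ih =>
    have hprev {p : ℕ → Prop} (h : ∀ s < t + 1, p s) : ∀ s < t, p s := fun s hs => h s (by lia)
    have hW := measurable_prod_mulIndicator (hprev hf) (hprev hB)
    set W : Ω → ENNReal := fun ω => ∏ s ∈ Finset.range t, (B s).mulIndicator (f s) ω
    have hBt := hB t t.lt_add_one
    have hBt' : MeasurableSet (B t) := ℱ.le t _ hBt
    have hsplit (ω : Ω) : ∏ s ∈ Finset.range (t + 1), (B s).mulIndicator (f s) ω =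
        (B t).indicator W ω * f t ω + (B t)ᶜ.indicator W ω := by
      rw [Finset.prod_range_succ]
      by_cases hω : ω ∈ B t <;> simp [W, hω]
    calc ∫⁻ ω, ∏ s ∈ Finset.range (t + 1), (B s).mulIndicator (f s) ω ∂μ
        = ∫⁻ ω, (B t).indicator W ω * f t ω ∂μ + ∫⁻ ω, (B t)ᶜ.indicator W ω ∂μ := by
          simp_rw [hsplit]
          exact lintegral_add_right _ ((hW.mono (ℱ.le t) le_rfl).indicator hBt'.compl)
      _ = (∫⁻ ω, (B t).indicator W ω ∂μ) * ∫⁻ ω, f t ω ∂μ + ∫⁻ ω, (B t)ᶜ.indicator W ω ∂μ := by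
          rw [lintegral_mul_eq_lintegral_mul_lintegral_of_independent_measurableSpace (ℱ.le t)
            ((hf t t.lt_add_one).mono (ℱ.le _) le_rfl).comap_le (hind t t.lt_add_one).symm
            (hW.indicator hBt) (comap_measurable (f t))]
      _ ≤ ∫⁻ ω, (B t).indicator W ω ∂μ + ∫⁻ ω, (B t)ᶜ.indicator W ω ∂μ := by
          gcongr
          exact mul_le_of_le_one_right' (hle t t.lt_add_one)
      _ = ∫⁻ ω, W ω ∂μ := by
          rw [lintegral_indicator hBt', lintegral_indicator hBt'.compl,
            lintegral_add_compl _ hBt']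
      _ ≤ 1 := ih (hprev hf) (hprev hind) (hprev hB) (hprev hle)

theorem lintegral_exp_mul_sub_le_one {Y : Ω → ℝ} {c : NNReal} (hY : HasSubgaussianMGF Y c μ)
    (l : ℝ) : ∫⁻ ω, ENNReal.ofReal (Real.exp (l * Y ω - c * l ^ 2 / 2)) ∂μ ≤ 1 := by
  simp only [sub_eq_add_neg, Real.exp_add]
  rw [← ofReal_integral_eq_lintegral_ofReal ((hY.integrable_exp_mul l).mul_const _)
    (.of_forall fun ω => by positivity), integral_mul_const, ENNReal.ofReal_le_one]
  calc mgf Y μ l * Real.exp (-(c * l ^ 2 / 2))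
      ≤ Real.exp (c * l ^ 2 / 2) * Real.exp (-(c * l ^ 2 / 2)) := by gcongr; exact hY.mgf_le l
    _ = 1 := by rw [← Real.exp_add, add_neg_cancel, Real.exp_zero]

theorem measure_le_sum_indicator_le [IsProbabilityMeasure μ] {Y : ℕ → Ω → ℝ} {c : NNReal}
    (hY : ∀ s < t, Measurable[ℱ (s + 1)] (Y s))
    (hind : ∀ s < t, Indep (MeasurableSpace.comap (Y s) inferInstance) (ℱ s) μ)
    (hB : ∀ s < t, MeasurableSet[ℱ s] (B s)) (hsub : ∀ s < t, HasSubgaussianMGF (Y s) c μ)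
    (l y : ℝ) :
    μ {ω | y ≤ ∑ s ∈ Finset.range t, (B s).indicator (fun ω => l * Y s ω - c * l ^ 2 / 2) ω} ≤
      ENNReal.ofReal (Real.exp (-y)) := by
  set h : ℝ → ENNReal := fun x => ENNReal.ofReal (Real.exp (l * x - c * l ^ 2 / 2))
  have hh : Measurable h := by fun_prop
  have hf : ∀ s < t, Measurable[ℱ (s + 1)] (h ∘ Y s) := fun s hs => hh.comp (hY s hs)
  have hone : ∫⁻ ω, ∏ s ∈ Finset.range t, (B s).mulIndicator (h ∘ Y s) ω ∂μ ≤ 1 := by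
    refine lintegral_prod_mulIndicator_le_one hf (fun s hs => ?_) hB fun s hs =>
      lintegral_exp_mul_sub_le_one (hsub s hs) l
    exact indep_of_indep_of_le_left (hind s hs) (hh.comp (comap_measurable (Y s))).comap_le
  have hprod (ω : Ω) : ∏ s ∈ Finset.range t, (B s).mulIndicator (h ∘ Y s) ω =
      ENNReal.ofReal (Real.exp
        (∑ s ∈ Finset.range t, (B s).indicator (fun ω => l * Y s ω - c * l ^ 2 / 2) ω)) := by
    rw [Real.exp_sum, ENNReal.ofReal_prod_of_nonneg fun _ _ => (Real.exp_pos _).le]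
    refine Finset.prod_congr rfl fun s _ => ?_
    by_cases hω : ω ∈ B s <;> simp [hω, h]
  calc _ = μ {ω | ENNReal.ofReal (Real.exp y) ≤
          ∏ s ∈ Finset.range t, (B s).mulIndicator (h ∘ Y s) ω} := by
        simp_rw [hprod, ENNReal.ofReal_le_ofReal_iff (Real.exp_pos _).le, Real.exp_le_exp]
    _ ≤ (∫⁻ ω, ∏ s ∈ Finset.range t, (B s).mulIndicator (h ∘ Y s) ω ∂μ) /
          ENNReal.ofReal (Real.exp y) :=
        meas_ge_le_lintegral_div
          ((measurable_prod_mulIndicator hf hB).mono (ℱ.le t) le_rfl).aemeasurable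
          (ENNReal.ofReal_pos.2 (Real.exp_pos y)).ne' ENNReal.ofReal_ne_top
    _ ≤ 1 / ENNReal.ofReal (Real.exp y) := by gcongr
    _ = ENNReal.ofReal (Real.exp (-y)) := by
        rw [one_div, ← ENNReal.ofReal_inv_of_pos (Real.exp_pos y), Real.exp_neg]

end PredictableProduct

theorem integral_le_add_mul_measureReal {Ω : Type*} [MeasurableSpace Ω] {μ : Measure Ω}
    [IsProbabilityMeasure μ] {f : Ω → ℝ} {s : Set Ω} {b c : ℝ} (hf : Integrable f μ)
    (hbc : ∀ ω, f ω ≤ b + c) (hb : ∀ ω ∉ s, f ω ≤ b) : ∫ ω, f ω ∂μ ≤ b + c * μ.real s := by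
  set s' := toMeasurable μ s
  have hs' : MeasurableSet s' := measurableSet_toMeasurable μ s
  have hint : Integrable (s'.indicator fun _ => c) μ := (integrable_const c).indicator hs'
  calc ∫ ω, f ω ∂μ ≤ ∫ ω, (b + s'.indicator (fun _ => c) ω) ∂μ := by
        refine integral_mono hf ((integrable_const b).add hint) fun ω => ?_
        by_cases hω : ω ∈ s'
        · simpa [hω] using hbc ω
        · simpa [hω] using hb ω fun h => hω (subset_toMeasurable μ s h)
    _ = b + c * μ.real s := by
        have hreal : μ.real s' = μ.real s := by
          rw [measureReal_def, measure_toMeasurable, measureReal_def]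
        rw [integral_add (integrable_const b) hint, integral_indicator_const c hs', integral_const,
          hreal, probReal_univ, one_smul, smul_eq_mul, mul_comm]

section Concentration

variable {k T : ℕ}

theorem pulls_mono (a : ℕ → SellerSet k) (γ : SellerSet k) : Monotone fun t => pulls a t γ :=
  fun _ _ hst => Finset.card_le_card (Finset.filter_subset_filter _ (Finset.range_mono hst))

theorem filter_pulls_lt_pulls (a : ℕ → SellerSet k) (γ : SellerSet k) {t : ℕ} (ht : t ≤ T) :
    {s ∈ Finset.range T | a s = γ ∧ pulls a s γ < pulls a t γ} =
      {s ∈ Finset.range t | a s = γ} := by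
  ext s
  simp only [Finset.mem_filter, Finset.mem_range]
  refine ⟨fun ⟨_, hs, hlt⟩ => ⟨(pulls_mono a γ).reflect_lt hlt, hs⟩, fun ⟨hst, hs⟩ =>
    ⟨hst.trans_le ht, hs, ?_⟩⟩
  have hle : pulls a (s + 1) γ ≤ pulls a t γ := pulls_mono a γ hst
  rw [pulls_succ, if_pos hs] at hle
  lia

theorem pulls_mul_empMean_sub (a : ℕ → SellerSet k) (r : ℕ → SellerSet k → ℝ) (t : ℕ)
    (γ : SellerSet k) (x : ℝ) :
    pulls a t γ * (empMean a r t γ - x) = ∑ s ∈ Finset.range t with a s = γ, (r s γ - x) := by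
  rw [Finset.sum_sub_distrib, Finset.sum_const, nsmul_eq_mul, ← pulls, mul_sub]
  congr 1
  refine mul_div_cancel_of_imp' fun h => ?_
  rw [pulls, Nat.cast_eq_zero, Finset.card_eq_zero] at h
  rw [h, Finset.sum_empty]

/-- With `m` pulls and a deviation equal to the radius `ρ`, the choice `l = ρ` maximizes
`m * (l * ρ - l ^ 2 / 2)`. -/
theorem exists_abs_eq_confRadius_three_mul_log_le {a : ℕ → SellerSet k} {r : ℕ → SellerSet k → ℝ}
    {t : ℕ} {γ : SellerSet k} {x : ℝ} (hpos : 0 < pulls a t γ)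
    (hdev : confRadius T a t γ ≤ |empMean a r t γ - x|) :
    ∃ l, |l| = confRadius T a t γ ∧
      3 * Real.log T ≤ ∑ s ∈ Finset.range t with a s = γ, (l * (r s γ - x) - l ^ 2 / 2) := by
  set ρ := confRadius T a t γ
  have hρ : 0 ≤ ρ := confRadius_nonneg T a t γ
  obtain ⟨l, hl, hlx⟩ : ∃ l, |l| = ρ ∧ ρ ^ 2 ≤ l * (empMean a r t γ - x) := by
    rcases le_abs.1 hdev with h | h
    · exact ⟨ρ, abs_of_nonneg hρ, by rw [sq]; gcongr⟩
    · exact ⟨-ρ, by rw [abs_neg, abs_of_nonneg hρ], by rw [sq, neg_mul, ← mul_neg]; gcongr⟩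
  refine ⟨l, hl, ?_⟩
  have hpulls : (1 : ℝ) ≤ pulls a t γ := mod_cast hpos
  have hlog := Real.log_natCast_nonneg T
  calc 3 * Real.log T ≤ pulls a t γ * (ρ ^ 2 / 2) := by
        rw [confRadius_sq, div_div, ← mul_div_assoc, le_div_iff₀ (by positivity)]
        nlinarith
    _ ≤ pulls a t γ * (l * (empMean a r t γ - x) - l ^ 2 / 2) := by
        rw [← sq_abs l, hl]
        gcongr
        linarith
    _ = ∑ s ∈ Finset.range t with a s = γ, (l * (r s γ - x) - l ^ 2 / 2) := by
        rw [Finset.sum_sub_distrib, ← Finset.mul_sum, ← pulls_mul_empMean_sub, Finset.sum_const,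
          nsmul_eq_mul, ← pulls]
        ring

variable {Ω : Type*}

/-- The event that the exponential supermartingale with parameter `l` of the deviations `Y`,
restricted to the first `m` selections of `γ`, is large at time `T`. -/
def deviationEvent (T : ℕ) (a : ℕ → Ω → SellerSet k) (Y : ℕ → Ω → ℝ) (γ : SellerSet k) (m : ℕ)
    (l : ℝ) : Set Ω :=
  {ω | 3 * Real.log T ≤ ∑ s ∈ Finset.range T,
    {ω | a s ω = γ ∧ pulls (fun t => a t ω) s γ < m}.indicator
      (fun ω => l * Y s ω - l ^ 2 / 2) ω}

theorem setOf_not_hasAccurateMeans_subset {a : ℕ → Ω → SellerSet k} {r : ℕ → Ω → SellerSet k → ℝ}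
    {u : SellerSet k → ℝ} (hu : ∀ γ, |u γ| ≤ √(12 * Real.log T)) :
    {ω | ¬ HasAccurateMeans T (fun t => a t ω) (fun t => r t ω) u} ⊆
      ⋃ γ, ⋃ m ∈ Finset.range T, ⋃ l ∈ ({√(12 * Real.log T / (m + 1)),
        -√(12 * Real.log T / (m + 1))} : Finset ℝ),
        deviationEvent T a (fun s ω => r s ω γ - u γ) γ m l := by
  intro ω hω
  simp only [HasAccurateMeans, Set.mem_ofPred_eq, not_forall, not_le] at hω
  obtain ⟨t, ht, γ, hdev⟩ := hω
  have hpos : 0 < pulls (fun t => a t ω) t γ := by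
    by_contra! hzero
    rw [nonpos_iff_eq_zero] at hzero
    rw [empMean, confRadius, hzero, Nat.cast_zero, div_zero, zero_sub, abs_neg, zero_add,
      div_one] at hdev
    exact absurd (hu γ) hdev.not_ge
  obtain ⟨l, hl, hsum⟩ := exists_abs_eq_confRadius_three_mul_log_le hpos hdev.le
  simp only [Set.mem_iUnion]
  refine ⟨γ, pulls (fun t => a t ω) t γ, Finset.mem_range.2 ((pulls_le _ t γ).trans_lt ht), l,
    ?_, ?_⟩
  · rw [Finset.mem_insert, Finset.mem_singleton]
    exact (abs_eq (confRadius_nonneg T _ t γ)).1 hl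
  · rw [← filter_pulls_lt_pulls _ γ ht.le, Finset.sum_filter] at hsum
    simpa only [deviationEvent, Set.mem_ofPred_eq, Set.indicator_apply] using hsum

variable [mΩ : MeasurableSpace Ω] {μ : Measure Ω} {ℱ : Filtration ℕ mΩ} {a : ℕ → Ω → SellerSet k}

theorem measurable_pulls {γ : SellerSet k} {t : ℕ}
    (ha : ∀ s < t, MeasurableSet[ℱ s] {ω | a s ω = γ}) :
    Measurable[ℱ t] fun ω => pulls (fun s => a s ω) t γ := by
  simp only [pulls, Finset.card_filter]
  refine Finset.measurable_sum _ fun s hs => ?_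
  have hst := Finset.mem_range.1 hs
  exact Measurable.ite (ℱ.mono hst.le _ (ha s hst)) measurable_const measurable_const

theorem measure_deviationEvent_le [IsProbabilityMeasure μ] {γ : SellerSet k} {Y : ℕ → Ω → ℝ}
    (ha : ∀ s < T, MeasurableSet[ℱ s] {ω | a s ω = γ}) (hY : ∀ s < T, Measurable[ℱ (s + 1)] (Y s))
    (hind : ∀ s < T, Indep (MeasurableSpace.comap (Y s) inferInstance) (ℱ s) μ)
    (hsub : ∀ s < T, HasSubgaussianMGF (Y s) 1 μ) (m : ℕ) (l : ℝ) :
    μ (deviationEvent T a Y γ m l) ≤ ENNReal.ofReal (Real.exp (-(3 * Real.log T))) := by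
  have hB : ∀ s < T, MeasurableSet[ℱ s] {ω | a s ω = γ ∧ pulls (fun t => a t ω) s γ < m} :=
    fun s hs => (ha s hs).inter
      (measurable_pulls (fun s' hs' => ha s' (hs'.trans hs)) measurableSet_Iio)
  simpa [deviationEvent] using measure_le_sum_indicator_le hY hind hB hsub l (3 * Real.log T)

theorem measureReal_not_hasAccurateMeans_le [IsProbabilityMeasure μ]
    {r : ℕ → Ω → SellerSet k → ℝ} {u : SellerSet k → ℝ}
    (ha : ∀ s < T, ∀ γ, MeasurableSet[ℱ s] {ω | a s ω = γ})
    (hr : ∀ s < T, ∀ γ, Measurable[ℱ (s + 1)] fun ω => r s ω γ)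
    (hind : ∀ s < T, ∀ γ, Indep (MeasurableSpace.comap (fun ω => r s ω γ) inferInstance) (ℱ s) μ)
    (hsub : ∀ s < T, ∀ γ, HasSubgaussianMGF (fun ω => r s ω γ - u γ) 1 μ)
    (hu : ∀ γ, |u γ| ≤ √(12 * Real.log T)) :
    μ.real {ω | ¬ HasAccurateMeans T (fun t => a t ω) (fun t => r t ω) u} ≤ 2 * 2 ^ k / T ^ 2 := by
  have hevent (γ : SellerSet k) (m : ℕ) (l : ℝ) :
      μ.real (deviationEvent T a (fun s ω => r s ω γ - u γ) γ m l) ≤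
        Real.exp (-(3 * Real.log T)) := by
    refine ENNReal.toReal_le_of_le_ofReal (Real.exp_pos _).le (measure_deviationEvent_le
      (fun s hs => ha s hs γ) (fun s hs => (hr s hs γ).sub_const _) (fun s hs => ?_)
      (fun s hs => hsub s hs γ) m l)
    exact indep_of_indep_of_le_left (hind s hs γ)
      ((comap_measurable fun ω => r s ω γ).sub_const (u γ)).comap_le
  calc μ.real {ω | ¬ HasAccurateMeans T (fun t => a t ω) (fun t => r t ω) u}
      ≤ ∑ γ : SellerSet k, ∑ m ∈ Finset.range T, ∑ l ∈ ({√(12 * Real.log T / (m + 1)),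
          -√(12 * Real.log T / (m + 1))} : Finset ℝ),
          μ.real (deviationEvent T a (fun s ω => r s ω γ - u γ) γ m l) := by
        refine (measureReal_mono (setOf_not_hasAccurateMeans_subset hu)).trans ?_
        refine (measureReal_iUnion_fintype_le _).trans (Finset.sum_le_sum fun γ _ => ?_)
        refine (measureReal_biUnion_finset_le _ _).trans (Finset.sum_le_sum fun m _ => ?_)
        exact measureReal_biUnion_finset_le _ _
    _ ≤ ∑ γ : SellerSet k, ∑ m ∈ Finset.range T, 2 * Real.exp (-(3 * Real.log T)) := by
        gcongr with γ _ m _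
        refine (Finset.sum_le_card_nsmul _ _ _ fun l _ => hevent γ m l).trans ?_
        rw [nsmul_eq_mul]
        gcongr
        exact_mod_cast Finset.card_le_two
    _ = 2 * 2 ^ k / T ^ 2 := by
        rcases T.eq_zero_or_pos with rfl | hT
        · simp
        have : (0 : ℝ) < T := mod_cast hT
        have hexp : Real.exp (-(3 * Real.log T)) = ((T : ℝ) ^ 3)⁻¹ := by
          rw [Real.exp_neg, ← Real.log_rpow this, Real.exp_log (by positivity)]
          norm_cast
        simp only [Finset.sum_const, Finset.card_univ, Finset.card_range, Fintype.card_finset,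
          Fintype.card_fin, nsmul_eq_mul, hexp]
        push_cast
        field_simp

end Concentration

namespace DataMarket

variable {n k : ℕ} (M : DataMarket n k) {α : ℝ}

theorem measurable_perf (i : Fin n) (γ : SellerSet k) :
    Measurable fun x : Draw n k => x.perf i γ := by
  unfold Draw.perf
  fun_prop

theorem measurable_ext (i j : Fin n) (γ : SellerSet k) :
    Measurable fun x : Draw n k => x.ext i j γ := by
  unfold Draw.ext
  fun_prop

theorem measurable_effUtility (i : Fin n) (γ : SellerSet k) :
    Measurable fun x => M.effUtility α x i γ :=
  ((measurable_perf i γ).sub_const _).sub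
    ((Finset.measurable_sum _ fun j _ => measurable_ext j i γ).const_mul α)

theorem integrable_gain (i : Fin n) (γ : SellerSet k) :
    Integrable (fun x => M.gain x i γ) M.law :=
  have := M.isProb
  (Integrable.of_mem_Icc 0 1 (measurable_perf i γ).aemeasurable (M.perf_mem i γ)).sub
    (integrable_const _)

theorem integrable_sum_ext_caused (i : Fin n) (γ : SellerSet k) :
    Integrable (fun x : Draw n k => ∑ j ∈ Finset.univ.erase i, x.ext j i γ) M.law :=
  integrable_finsetSum _ fun j hj => M.ext_integrable j i (Finset.ne_of_mem_erase hj) γ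

theorem integrable_sum_ext_suffered (i : Fin n) (S : Fin n → SellerSet k) :
    Integrable (fun x : Draw n k => ∑ j ∈ Finset.univ.erase i, x.ext i j (S j)) M.law :=
  integrable_finsetSum _ fun j hj => M.ext_integrable i j (Finset.ne_of_mem_erase hj).symm _

theorem integrable_effUtility (i : Fin n) (γ : SellerSet k) :
    Integrable (fun x => M.effUtility α x i γ) M.law :=
  (M.integrable_gain i γ).sub ((M.integrable_sum_ext_caused i γ).const_mul α)

theorem integrable_utility (i : Fin n) (S : Fin n → SellerSet k) :
    Integrable (fun x => M.utility α x i S) M.law :=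
  ((M.integrable_gain i (S i)).sub (M.integrable_sum_ext_suffered i S)).sub
    (((M.integrable_sum_ext_caused i (S i)).sub (M.integrable_sum_ext_suffered i S)).const_mul α)

theorem effUtility_mem (hα : α ∈ Set.Icc (0 : ℝ) 1) (i : Fin n) (γ : SellerSet k) :
    ∀ᵐ x ∂M.law, M.effUtility α x i γ ∈ Set.Icc (-1 - M.cost γ) (1 - M.cost γ) := by
  filter_upwards [M.perf_mem i γ, M.ext_mem i γ] with x hperf hext
  have hnonneg := mul_nonneg hα.1 hext.1
  have hle_one := mul_le_one₀ hα.2 hext.1 hext.2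
  rw [effUtility, gain]
  exact ⟨by linarith [hperf.1], by linarith [hperf.2]⟩

theorem abs_meanEffUtility_le (hα : α ∈ Set.Icc (0 : ℝ) 1) (i : Fin n) (γ : SellerSet k) :
    |M.meanEffUtility α i γ| ≤ 2 := by
  have := M.isProb
  have hmean : M.meanEffUtility α i γ ∈ Set.Icc (-1 - M.cost γ) (1 - M.cost γ) :=
    (convex_Icc _ _).integral_mem isClosed_Icc (M.effUtility_mem hα i γ)
      (M.integrable_effUtility i γ)
  have hcost := M.cost_mem γ
  exact abs_le.2 ⟨by linarith [hmean.1, hcost.2], by linarith [hmean.2, hcost.1]⟩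

theorem hasSubgaussianMGF_effUtility (hα : α ∈ Set.Icc (0 : ℝ) 1) (i : Fin n) (γ : SellerSet k) :
    HasSubgaussianMGF (fun x => M.effUtility α x i γ - M.meanEffUtility α i γ) 1 M.law := by
  have := M.isProb
  have hoeffding := hasSubgaussianMGF_of_mem_Icc (M.measurable_effUtility i γ).aemeasurable
    (M.effUtility_mem hα i γ)
  have hwidth : ((‖(1 - M.cost γ) - (-1 - M.cost γ)‖₊ / 2) ^ 2 : NNReal) = 1 := by
    rw [show (1 - M.cost γ) - (-1 - M.cost γ) = 2 by ring]
    simp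
  rwa [hwidth] at hoeffding

/-- In the sum the transaction costs cancel, and the externalities suffered by all buyers add up to
those caused by all buyers. -/
theorem sum_utility (x : Draw n k) (S : Fin n → SellerSet k) :
    ∑ i, M.utility α x i S = ∑ i, (M.effUtility α x i (S i)
      - (1 - α) * ∑ j ∈ Finset.univ.erase i, x.ext j i (S i)) := by
  have hswap : ∑ i, ∑ j ∈ Finset.univ.erase i, x.ext i j (S j) =
      ∑ i, ∑ j ∈ Finset.univ.erase i, x.ext j i (S i) :=
    Finset.sum_comm' (by simp [eq_comm])
  simp only [utility, transactionCost, effUtility, Finset.sum_sub_distrib, ← Finset.mul_sum, hswap]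
  ring

theorem sum_utility_sub_le (hα : α ≤ 1) {x : Draw n k}
    (hx : ∀ i γ, ∑ j ∈ Finset.univ.erase i, x.ext j i γ ∈ Set.Icc (0 : ℝ) 1)
    (S S' : Fin n → SellerSet k) :
    ∑ i, (M.utility α x i S - M.utility α x i S') ≤
      n * (1 - α) + ∑ i, (M.effUtility α x i (S i) - M.effUtility α x i (S' i)) := by
  have hα' : 0 ≤ 1 - α := sub_nonneg.2 hα
  have hn : (n : ℝ) * (1 - α) = ∑ _i : Fin n, (1 - α) := by simp [mul_sub]
  rw [Finset.sum_sub_distrib, sum_utility, sum_utility, ← Finset.sum_sub_distrib, hn,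
    ← Finset.sum_add_distrib]
  refine Finset.sum_le_sum fun i _ => ?_
  have hS := mul_nonneg hα' (hx i (S i)).1
  have hS' := mul_le_of_le_one_right hα' (hx i (S' i)).2
  linarith

end DataMarket

namespace IsZoomingPlay

variable {n k T : ℕ} {M : DataMarket n k} {α lam : ℝ} {Ω : Type*} [mΩ : MeasurableSpace Ω]
  {μ : Measure Ω} {ℱ : Filtration ℕ mΩ} {X : ℕ → Ω → Draw n k}
  {A : ℕ → Fin n → Ω → Finset (SellerSet k)} {a : ℕ → Fin n → Ω → SellerSet k}

theorem measurable_draw (hp : IsZoomingPlay M α lam T μ ℱ X A a) {t : ℕ} (ht : t < T) :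
    Measurable (X t) :=
  (hp.draw_measurable t ht).mono (ℱ.le _) le_rfl

theorem measurableSet_profile (hp : IsZoomingPlay M α lam T μ ℱ X A a) {t : ℕ} (ht : t < T)
    (S : Fin n → SellerSet k) : MeasurableSet {ω | (fun j => a t j ω) = S} := by
  simp only [funext_iff, Set.ofPred_forall]
  exact MeasurableSet.iInter fun j => ℱ.le t _ (hp.order_measurable t ht j (S j))

theorem ae_draw (hp : IsZoomingPlay M α lam T μ ℱ X A a) {t : ℕ} (ht : t < T)
    {p : Draw n k → Prop} (h : ∀ᵐ x ∂M.law, p x) : ∀ᵐ ω ∂μ, p (X t ω) :=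
  ae_of_ae_map (hp.measurable_draw ht).aemeasurable (hp.draw_law t ht ▸ h)

theorem integrable_draw (hp : IsZoomingPlay M α lam T μ ℱ X A a) {t : ℕ} (ht : t < T)
    {f : Draw n k → ℝ} (hf : Integrable f M.law) : Integrable (fun ω => f (X t ω)) μ :=
  (hp.draw_law t ht ▸ hf : Integrable f (μ.map (X t))).comp_measurable (hp.measurable_draw ht)

theorem integrable_sum_effUtility_sub (hp : IsZoomingPlay M α lam T μ ℱ X A a)
    (S : Fin n → SellerSet k) (i : Fin n) :
    Integrable (fun ω => ∑ t ∈ Finset.range T,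
      (M.effUtility α (X t ω) i (S i) - M.effUtility α (X t ω) i (a t i ω))) μ := by
  refine integrable_finsetSum _ fun t ht => ?_
  have ht := Finset.mem_range.1 ht
  exact integrable_selected (b := a t i)
    (g := fun γ ω => M.effUtility α (X t ω) i (S i) - M.effUtility α (X t ω) i γ)
    (fun γ => ℱ.le t _ (hp.order_measurable t ht i γ)) fun γ =>
    hp.integrable_draw ht ((M.integrable_effUtility i (S i)).sub (M.integrable_effUtility i γ))

theorem integrable_sum_utility_sub (hp : IsZoomingPlay M α lam T μ ℱ X A a)
    (S : Fin n → SellerSet k) (i : Fin n) :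
    Integrable (fun ω => ∑ t ∈ Finset.range T,
      (M.utility α (X t ω) i S - M.utility α (X t ω) i fun j => a t j ω)) μ := by
  refine integrable_finsetSum _ fun t ht => ?_
  have ht := Finset.mem_range.1 ht
  exact integrable_selected (b := fun ω j => a t j ω)
    (g := fun S' ω => M.utility α (X t ω) i S - M.utility α (X t ω) i S')
    (hp.measurableSet_profile ht) fun S' =>
    hp.integrable_draw ht ((M.integrable_utility i S).sub (M.integrable_utility i S'))

variable [IsProbabilityMeasure μ]

theorem integrable_sum_gap (hp : IsZoomingPlay M α lam T μ ℱ X A a) (S : Fin n → SellerSet k)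
    (i : Fin n) :
    Integrable (fun ω => ∑ t ∈ Finset.range T,
      (M.meanEffUtility α i (S i) - M.meanEffUtility α i (a t i ω))) μ := by
  refine integrable_finsetSum _ fun t ht => ?_
  exact integrable_selected (b := a t i)
    (g := fun γ _ => M.meanEffUtility α i (S i) - M.meanEffUtility α i γ)
    (fun γ => ℱ.le t _ (hp.order_measurable t (Finset.mem_range.1 ht) i γ))
    fun γ => integrable_const _

/-- The orders of a round are chosen before its outcome is drawn, which permits replacing utilities
by their means. -/
theorem onlineEffRegret_eq_integral_sum_gap (hp : IsZoomingPlay M α lam T μ ℱ X A a)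
    (S : Fin n → SellerSet k) (i : Fin n) :
    onlineEffRegret M α T μ X a S i = ∫ ω, ∑ t ∈ Finset.range T,
      (M.meanEffUtility α i (S i) - M.meanEffUtility α i (a t i ω)) ∂μ := by
  let g (γ : SellerSet k) (x : Draw n k) : ℝ := M.effUtility α x i (S i) - M.effUtility α x i γ
  have hg (γ : SellerSet k) : Integrable (g γ) M.law :=
    (M.integrable_effUtility i (S i)).sub (M.integrable_effUtility i γ)
  have hround : ∀ t ∈ Finset.range T, ∫ ω, g (a t i ω) (X t ω) ∂μ =
      ∫ ω, (M.meanEffUtility α i (S i) - M.meanEffUtility α i (a t i ω)) ∂μ := by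
    intro t ht
    have ht := Finset.mem_range.1 ht
    rw [integral_selected (ℱ.le t) (hp.measurable_draw ht) (hp.draw_indep t ht)
      (hp.order_measurable t ht i) fun γ => hp.draw_law t ht ▸ hg γ, hp.draw_law t ht]
    exact integral_congr_ae <| .of_forall fun ω =>
      integral_sub (M.integrable_effUtility i (S i)) (M.integrable_effUtility i (a t i ω))
  have hprev {t : ℕ} (ht : t ∈ Finset.range T) (γ : SellerSet k) :
      MeasurableSet {ω | a t i ω = γ} :=
    ℱ.le t _ (hp.order_measurable t (Finset.mem_range.1 ht) i γ)
  rw [onlineEffRegret, integral_finsetSum _ fun t ht => integrable_selected (hprev ht) fun γ =>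
      hp.integrable_draw (Finset.mem_range.1 ht) (hg γ),
    integral_finsetSum _ fun t ht => integrable_selected (hprev ht) fun γ =>
      integrable_const (M.meanEffUtility α i (S i) - M.meanEffUtility α i γ)]
  exact Finset.sum_congr rfl hround

theorem onlineEffRegret_le_of_isDominantProfile (hp : IsZoomingPlay M α lam T μ ℱ X A a)
    {Sd : Fin n → SellerSet k} (hSd : M.IsDominantProfile α Sd) (S : Fin n → SellerSet k)
    (i : Fin n) : onlineEffRegret M α T μ X a S i ≤ onlineEffRegret M α T μ X a Sd i := by
  rw [hp.onlineEffRegret_eq_integral_sum_gap, hp.onlineEffRegret_eq_integral_sum_gap]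
  refine integral_mono (hp.integrable_sum_gap S i) (hp.integrable_sum_gap Sd i) fun ω => ?_
  dsimp only
  gcongr
  exact hSd i (S i)

theorem onlineWelfareRegret_le_sum_onlineEffRegret (hp : IsZoomingPlay M α lam T μ ℱ X A a)
    (hα : α ≤ 1) (S : Fin n → SellerSet k) :
    onlineWelfareRegret M α T μ X a S ≤
      T * n * (1 - α) + ∑ i, onlineEffRegret M α T μ X a S i := by
  have hext : ∀ᵐ ω ∂μ, ∀ t ∈ Finset.range T, ∀ i γ,
      ∑ j ∈ Finset.univ.erase i, (X t ω).ext j i γ ∈ Set.Icc (0 : ℝ) 1 := by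
    rw [Finset.eventually_all]
    intro t ht
    exact hp.ae_draw (Finset.mem_range.1 ht)
      (ae_all_iff.2 fun i => ae_all_iff.2 fun γ => M.ext_mem i γ)
  have hint : Integrable (fun ω => ∑ i, ∑ t ∈ Finset.range T,
      (M.effUtility α (X t ω) i (S i) - M.effUtility α (X t ω) i (a t i ω))) μ :=
    integrable_finsetSum _ fun i _ => hp.integrable_sum_effUtility_sub S i
  calc onlineWelfareRegret M α T μ X a S
      = ∫ ω, ∑ i, ∑ t ∈ Finset.range T,
          (M.utility α (X t ω) i S - M.utility α (X t ω) i fun j => a t j ω) ∂μ :=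
        (integral_finsetSum _ fun i _ => hp.integrable_sum_utility_sub S i).symm
    _ ≤ ∫ ω, (T * n * (1 - α) + ∑ i, ∑ t ∈ Finset.range T,
          (M.effUtility α (X t ω) i (S i) - M.effUtility α (X t ω) i (a t i ω))) ∂μ := by
        refine integral_mono_ae (integrable_finsetSum _ fun i _ =>
          hp.integrable_sum_utility_sub S i) ((integrable_const _).add hint) ?_
        filter_upwards [hext] with ω hω
        have hT : (T * n * (1 - α) : ℝ) = ∑ _t ∈ Finset.range T, (n * (1 - α) : ℝ) := by
          simp [mul_assoc]
        rw [Finset.sum_comm, Finset.sum_comm (s := Finset.univ), hT, ← Finset.sum_add_distrib]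
        exact Finset.sum_le_sum fun t ht => M.sum_utility_sub_le hα (hω t ht) S _
    _ = T * n * (1 - α) + ∑ i, onlineEffRegret M α T μ X a S i := by
        rw [integral_add (integrable_const _) hint, integral_const, probReal_univ, one_smul,
          integral_finsetSum _ fun i _ => hp.integrable_sum_effUtility_sub S i]
        rfl

theorem onlineWelfareRegret_le (hp : IsZoomingPlay M α lam T μ ℱ X A a) (hα : α ≤ 1)
    {Sd : Fin n → SellerSet k} (hSd : M.IsDominantProfile α Sd) (S : Fin n → SellerSet k) :
    onlineWelfareRegret M α T μ X a S ≤
      T * n * (1 - α) + ∑ i, onlineEffRegret M α T μ X a Sd i :=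
  (hp.onlineWelfareRegret_le_sum_onlineEffRegret hα S).trans <| by
    gcongr with i
    exact hp.onlineEffRegret_le_of_isDominantProfile hSd S i

theorem measureReal_not_hasAccurateMeans_effUtility_le (hp : IsZoomingPlay M α lam T μ ℱ X A a)
    (hT : 1 / 2 ≤ Real.log T) (hα : α ∈ Set.Icc (0 : ℝ) 1) (i : Fin n) :
    μ.real {ω | ¬ HasAccurateMeans T (fun t => a t i ω)
      (fun t γ => M.effUtility α (X t ω) i γ) (M.meanEffUtility α i)} ≤ 2 * 2 ^ k / T ^ 2 := by
  refine measureReal_not_hasAccurateMeans_le (ℱ := ℱ) (a := fun t => a t i)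
    (fun t ht => hp.order_measurable t ht i)
    (fun t ht γ => (M.measurable_effUtility i γ).comp (hp.draw_measurable t ht))
    (fun t ht γ => ?_) (fun t ht γ => ?_) fun γ => (M.abs_meanEffUtility_le hα i γ).trans ?_
  · exact indep_of_indep_of_le_left (hp.draw_indep t ht)
      ((M.measurable_effUtility i γ).comp (comap_measurable (X t))).comap_le
  · exact .of_map (hp.measurable_draw ht).aemeasurable
      (hp.draw_law t ht ▸ M.hasSubgaussianMGF_effUtility hα i γ)
  · exact Real.le_sqrt_of_sq_le (by linarith)

theorem onlineEffRegret_le_mul (hp : IsZoomingPlay M α lam T μ ℱ X A a) (hlam : 0 ≤ lam)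
    {Sd : Fin n → SellerSet k} (hclose : M.Closeness α lam Sd) (i : Fin n) :
    onlineEffRegret M α T μ X a Sd i ≤ lam * T := by
  rw [hp.onlineEffRegret_eq_integral_sum_gap]
  calc _ ≤ ∫ _, lam * T ∂μ :=
        integral_mono (hp.integrable_sum_gap Sd i) (integrable_const _) fun ω =>
          IsHammingClose.sum_gap_le (hclose i) hlam (fun t => a t i ω) T
    _ = lam * T := by simp

theorem onlineEffRegret_le_of_le_sqrt (hp : IsZoomingPlay M α lam T μ ℱ X A a) (hlam : 0 < lam)
    (hT : 1 / 2 ≤ Real.log T) (hlamT : lam ≤ √(12 * Real.log T)) (hα : α ∈ Set.Icc (0 : ℝ) 1)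
    {Sd : Fin n → SellerSet k} (hclose : M.Closeness α lam Sd) (i : Fin n) :
    onlineEffRegret M α T μ X a Sd i ≤
      (k + 1) * √(108 * (T * Real.log T)) + 1944 * k ^ 3 * Real.log T * (5 / 3) ^ k / lam +
        2 * lam * 2 ^ k / T := by
  set b := (k + 1) * √(108 * (T * Real.log T)) + 1944 * k ^ 3 * Real.log T * (5 / 3) ^ k / lam
  have hb : 0 ≤ b := by positivity
  rw [hp.onlineEffRegret_eq_integral_sum_gap]
  refine (integral_le_add_mul_measureReal (hp.integrable_sum_gap Sd i) (b := b) (c := lam * T)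
    (s := {ω | ¬ HasAccurateMeans T (fun t => a t i ω) (fun t γ => M.effUtility α (X t ω) i γ)
      (M.meanEffUtility α i)}) (fun ω => ?_) fun ω hω => ?_).trans ?_
  · exact (IsHammingClose.sum_gap_le (hclose i) hlam.le (fun t => a t i ω) T).trans
      (le_add_of_nonneg_left hb)
  · exact (hp.zooming i ω).sum_gap_le hlam hlamT (not_not.1 hω) (hclose i)
  · calc b + lam * T * μ.real _ ≤ b + lam * T * (2 * 2 ^ k / T ^ 2) := by
          gcongr
          exact hp.measureReal_not_hasAccurateMeans_effUtility_le hT hα i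
      _ = b + 2 * lam * 2 ^ k / T := by
          field_simp

end IsZoomingPlay

/-- The rate `k² √(T log T) + k³ log² T 2^(3k/4)` at which the online effective regret of a single
buyer grows. -/
noncomputable def regretRate (k T : ℕ) : ℝ :=
  (k : ℝ) ^ 2 * √(T * Real.log T) + (k : ℝ) ^ 3 * Real.log T ^ 2 * 2 ^ (3 * (k : ℝ) / 4)

/-- The constant, depending only on the closeness parameter, in front of `regretRate`. -/
noncomputable def regretConstant (lam : ℝ) : ℝ :=
  22 + lam * (8 + Real.exp (lam ^ 2 / 12)) + 3888 / lam

section Rate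

variable {k T : ℕ}

theorem one_half_le_log (hT : 2 ≤ T) : 1 / 2 ≤ Real.log T := by
  have hlog : Real.log 2 ≤ Real.log T := by gcongr; exact_mod_cast hT
  linarith [Real.log_two_gt_d9]

theorem regretRate_nonneg (k T : ℕ) : 0 ≤ regretRate k T := by
  unfold regretRate
  positivity

theorem one_le_regretRate (hk : 1 ≤ k) (hT : 2 ≤ T) : 1 ≤ regretRate k T := by
  have hT' : (2 : ℝ) ≤ T := mod_cast hT
  have hsqrt : 1 ≤ √(T * Real.log T) :=
    Real.one_le_sqrt.2 (by nlinarith [one_half_le_log hT])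
  exact (one_le_mul_of_one_le_of_one_le (one_le_pow₀ (mod_cast hk)) hsqrt).trans
    (le_add_of_nonneg_right (by positivity))

theorem log_mul_rpow_le (k : ℕ) (hT : 2 ≤ T) :
    Real.log T * 2 ^ (3 * (k : ℝ) / 4) ≤ 2 * (Real.log T ^ 2 * 2 ^ (3 * (k : ℝ) / 4)) := by
  have hlog : Real.log T ≤ 2 * Real.log T ^ 2 := by nlinarith [one_half_le_log hT]
  calc _ ≤ 2 * Real.log T ^ 2 * 2 ^ (3 * (k : ℝ) / 4) := by gcongr
    _ = _ := mul_assoc ..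

theorem rpow_le_four_mul_regretRate (hk : 1 ≤ k) (hT : 2 ≤ T) :
    2 ^ (3 * (k : ℝ) / 4) ≤ 4 * regretRate k T := by
  have hlog : 1 ≤ 4 * Real.log T ^ 2 := by nlinarith [one_half_le_log hT]
  have hk' : (1 : ℝ) ≤ k ^ 3 := one_le_pow₀ (mod_cast hk)
  calc (2 : ℝ) ^ (3 * (k : ℝ) / 4)
      ≤ k ^ 3 * (4 * Real.log T ^ 2) * 2 ^ (3 * (k : ℝ) / 4) :=
        le_mul_of_one_le_left (by positivity) (one_le_mul_of_one_le_of_one_le hk' hlog)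
    _ = 4 * (k ^ 3 * Real.log T ^ 2 * 2 ^ (3 * (k : ℝ) / 4)) := by ring
    _ ≤ 4 * regretRate k T := by
        gcongr
        exact le_add_of_nonneg_left (by positivity)

theorem near_add_far_le_mul_regretRate (hk : 1 ≤ k) (hT : 2 ≤ T) {lam : ℝ} (hlam : 0 < lam) :
    (k + 1) * √(108 * (T * Real.log T)) + 1944 * k ^ 3 * Real.log T * (5 / 3) ^ k / lam ≤
      (22 + 3888 / lam) * regretRate k T := by
  have hk' : (1 : ℝ) ≤ k := mod_cast hk
  have hsqrt : √108 ≤ 11 := Real.sqrt_le_iff.2 (by norm_num)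
  have hnear : (k + 1) * √(108 * (T * Real.log T)) ≤ 22 * (k ^ 2 * √(T * Real.log T)) := by
    rw [Real.sqrt_mul (by norm_num)]
    calc (k + 1) * (√108 * √(T * Real.log T))
        ≤ (2 * k ^ 2) * (11 * √(T * Real.log T)) := by gcongr; nlinarith
      _ = 22 * (k ^ 2 * √(T * Real.log T)) := by ring
  have hfar : 1944 * k ^ 3 * Real.log T * (5 / 3) ^ k / lam ≤
      3888 / lam * (k ^ 3 * Real.log T ^ 2 * 2 ^ (3 * (k : ℝ) / 4)) :=
    calc _ ≤ 1944 * k ^ 3 * Real.log T * 2 ^ (3 * (k : ℝ) / 4) / lam := by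
          gcongr
          exact five_thirds_pow_le k
      _ = 1944 / lam * k ^ 3 * (Real.log T * 2 ^ (3 * (k : ℝ) / 4)) := by ring
      _ ≤ 1944 / lam * k ^ 3 * (2 * (Real.log T ^ 2 * 2 ^ (3 * (k : ℝ) / 4))) := by
          gcongr ?_ * ?_
          exact log_mul_rpow_le k hT
      _ = _ := by ring
  calc _ ≤ 22 * (k ^ 2 * √(T * Real.log T)) +
        3888 / lam * (k ^ 3 * Real.log T ^ 2 * 2 ^ (3 * (k : ℝ) / 4)) := add_le_add hnear hfar
    _ ≤ 22 * regretRate k T + 3888 / lam * regretRate k T := by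
        gcongr
        · exact le_add_of_nonneg_right (by positivity)
        · exact le_add_of_nonneg_left (by positivity)
    _ = _ := (add_mul ..).symm

theorem two_pow_le_rpow_sq (k : ℕ) : (2 : ℝ) ^ k ≤ (2 ^ (3 * (k : ℝ) / 4)) ^ 2 := by
  rw [← Real.rpow_mul_natCast zero_le_two, ← Real.rpow_natCast]
  gcongr
  · norm_num
  · push_cast
    linarith [(k.cast_nonneg : (0 : ℝ) ≤ k)]

variable {lam : ℝ}

theorem mul_natCast_le_of_sqrt_log_lt (hk : 1 ≤ k) (hT : 2 ≤ T) (h : √(12 * Real.log T) < lam) :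
    lam * T ≤ lam * Real.exp (lam ^ 2 / 12) * regretRate k T := by
  have hlam : 0 < lam := (Real.sqrt_nonneg _).trans_lt h
  have hTexp : (T : ℝ) ≤ Real.exp (lam ^ 2 / 12) := by
    rw [← Real.log_le_iff_le_exp (by positivity)]
    linarith [(Real.sqrt_lt' hlam).1 h]
  calc lam * T ≤ lam * Real.exp (lam ^ 2 / 12) := by gcongr
    _ ≤ _ := le_mul_of_one_le_right (by positivity) (one_le_regretRate hk hT)

theorem mul_natCast_le_of_le_rpow (hk : 1 ≤ k) (hT : 2 ≤ T) (hlam : 0 ≤ lam)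
    (h : T ≤ (2 : ℝ) ^ (3 * (k : ℝ) / 4)) : lam * T ≤ lam * 4 * regretRate k T :=
  calc lam * T ≤ lam * (4 * regretRate k T) := by
        gcongr
        exact h.trans (rpow_le_four_mul_regretRate hk hT)
    _ = lam * 4 * regretRate k T := (mul_assoc ..).symm

theorem mul_two_pow_div_le_of_rpow_le (hk : 1 ≤ k) (hT : 2 ≤ T) (hlam : 0 ≤ lam)
    (h : (2 : ℝ) ^ (3 * (k : ℝ) / 4) ≤ T) :
    2 * lam * 2 ^ k / T ≤ lam * 8 * regretRate k T := by
  have hQ := rpow_le_four_mul_regretRate hk hT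
  have hsq := two_pow_le_rpow_sq k
  set Q : ℝ := 2 ^ (3 * (k : ℝ) / 4)
  calc 2 * lam * 2 ^ k / T ≤ 2 * lam * (Q * T) / T := by
        gcongr
        calc (2 : ℝ) ^ k ≤ Q ^ 2 := hsq
          _ ≤ Q * T := by rw [sq]; gcongr
    _ = 2 * lam * Q := by field_simp
    _ ≤ 2 * lam * (4 * regretRate k T) := by gcongr
    _ = lam * 8 * regretRate k T := by ring

end Rate

/-- If `√(12 log T) < λ` or `T ≤ 2^(3k/4)`, the trivial bound `λ T` is of the right order. -/
theorem IsZoomingPlay.onlineEffRegret_le {n k : ℕ} {M : DataMarket n k} {α lam : ℝ} {T : ℕ}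
    {Ω : Type*} [mΩ : MeasurableSpace Ω] {μ : Measure Ω} [IsProbabilityMeasure μ]
    {ℱ : Filtration ℕ mΩ} {X : ℕ → Ω → Draw n k} {A : ℕ → Fin n → Ω → Finset (SellerSet k)}
    {a : ℕ → Fin n → Ω → SellerSet k} (hp : IsZoomingPlay M α lam T μ ℱ X A a)
    (hlam : 0 < lam) (hk : 1 ≤ k) (hT : 2 ≤ T) (hα : α ∈ Set.Icc (0 : ℝ) 1)
    {Sd : Fin n → SellerSet k} (hclose : M.Closeness α lam Sd) (i : Fin n) :
    onlineEffRegret M α T μ X a Sd i ≤ regretConstant lam * regretRate k T := by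
  suffices ∃ c ≤ regretConstant lam, onlineEffRegret M α T μ X a Sd i ≤ c * regretRate k T by
    obtain ⟨c, hc, h⟩ := this
    exact h.trans (mul_le_mul_of_nonneg_right hc (regretRate_nonneg k T))
  have hexp : 0 < lam * Real.exp (lam ^ 2 / 12) := by positivity
  have hdiv : 0 < 3888 / lam := by positivity
  have hlinear := hp.onlineEffRegret_le_mul hlam.le hclose i
  unfold regretConstant
  rcases lt_or_ge (√(12 * Real.log T)) lam with hlog | hlog
  · exact ⟨lam * Real.exp (lam ^ 2 / 12), by linarith,
      hlinear.trans (mul_natCast_le_of_sqrt_log_lt hk hT hlog)⟩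
  rcases le_total (T : ℝ) (2 ^ (3 * (k : ℝ) / 4)) with hTk | hTk
  · exact ⟨lam * 4, by linarith, hlinear.trans (mul_natCast_le_of_le_rpow hk hT hlam.le hTk)⟩
  · refine ⟨22 + 3888 / lam + lam * 8, by linarith, ?_⟩
    rw [add_mul]
    exact (hp.onlineEffRegret_le_of_le_sqrt hlam (one_half_le_log hT) hlog hα hclose i).trans
      (add_le_add (near_add_far_le_mul_regretRate hk hT hlam)
        (mul_two_pow_div_le_of_rpow_le hk hT hlam.le hTk))

theorem one_le_regretConstant {lam : ℝ} (hlam : 0 < lam) : 1 ≤ regretConstant lam := by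
  have hrest : 0 < lam * (8 + Real.exp (lam ^ 2 / 12)) + 3888 / lam := by positivity
  unfold regretConstant
  linarith

theorem mainTheorem3 :
    ∃ C₀ : ℝ, 0 < C₀ ∧ ∀ lam : ℝ, 0 < lam → ∃ C : ℝ, 0 < C ∧
      ∀ (n k T : ℕ), 1 ≤ k → 2 ≤ T → ∀ α ∈ Set.Icc (0 : ℝ) 1,
      ∀ (M : DataMarket n k) (Sd Sopt : Fin n → SellerSet k),
        M.IsDominantProfile α Sd → M.Closeness α lam Sd → M.IsSocialOptimum α Sopt →
      ∀ (Ω : Type*) (mΩ : MeasurableSpace Ω) (μ : Measure Ω) (_ : IsProbabilityMeasure μ)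
        (ℱ : Filtration ℕ mΩ) (X : ℕ → Ω → Draw n k)
        (A : ℕ → Fin n → Ω → Finset (SellerSet k)) (a : ℕ → Fin n → Ω → SellerSet k),
        IsZoomingPlay M α lam T μ ℱ X A a →
        onlineWelfareRegret M α T μ X a Sopt
            ≤ C₀ * (T * n * (1 - α)) + ∑ i, onlineEffRegret M α T μ X a Sd i ∧
        C₀ * (T * n * (1 - α)) + ∑ i, onlineEffRegret M α T μ X a Sd i
            ≤ C * (T * n * (1 - α) + n * (k : ℝ) ^ 2 * Real.sqrt (T * Real.log T)
                + n * (k : ℝ) ^ 3 * (Real.log T) ^ 2 * (2 : ℝ) ^ (3 * (k : ℝ) / 4)) := by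
  refine ⟨1, one_pos, fun lam hlam =>
    ⟨regretConstant lam, one_pos.trans_le (one_le_regretConstant hlam), ?_⟩⟩
  intro n k T hk hT α hα M Sd Sopt hSd hclose _ Ω mΩ μ hμ ℱ X A a hp
  rw [one_mul]
  refine ⟨hp.onlineWelfareRegret_le hα.2 hSd Sopt, ?_⟩
  have hloss : 0 ≤ (T : ℝ) * n * (1 - α) := mul_nonneg (by positivity) (sub_nonneg.2 hα.2)
  have hregret : ∑ i, onlineEffRegret M α T μ X a Sd i ≤
      n * (regretConstant lam * regretRate k T) := by
    simpa using Finset.sum_le_card_nsmul Finset.univ _ _ fun i _ =>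
      hp.onlineEffRegret_le hlam hk hT hα hclose i
  calc _ ≤ regretConstant lam * (T * n * (1 - α)) + n * (regretConstant lam * regretRate k T) :=
        add_le_add (le_mul_of_one_le_left hloss (one_le_regretConstant hlam)) hregret
    _ = _ := by rw [regretRate]; ring
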